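/- Let $N\ge 2$, let $\Omega\subset\mathbb R^N$ be a bounded open set, and let $\mu^+$ be a finite Borel measure on $\Sigma:=[0,1]\times(1,N)$ such that $\mu^+([\overline s,1]\times[\overline p,N))>0$ for some $(\overline s,\overline p)\in(0,1]\times(1,N)$. For $(s,p)\in\Sigma$ and $u\in C_c^\infty(\Omega)$ (extended by zero to $\mathbb R^N$) set $[u]_{0,p}:=\|u\|_{L^p(\mathbb R^N)}$, $[u]_{1,p}:=\|\nabla u\|_{L^p(\mathbb R^N)}$ and, for $s\in(0,1)$, $$[u]_{s,p}:=\left(c_{N,s,p}\iint_{\mathbb R^{2N}}\frac{|u(x)-u(y)|^p}{|x-y|^{N+sp}}\,dx\,dy\right)^{1/p},\qquad c_{N,s,p}:=\frac{s\,2^{2s}\,\Gamma\left(\frac{ps+p+N-2}{2}\right)}{\pi^{N/2}\,\Gamma(1-s)} .$$ Let $\mathcal X_\mu(\Omega)$ be the completion of $C_c^\infty(\Omega)$ with respect to the norm $\|u\|_\mu:=\iint_\Sigma[u]_{s,p}\,d\mu^+(s,p)$. Let $W_0^{1,p}(\Omega)$ be the closure of $C_c^\infty(\Omega)$ in $W^{1,p}(\Omega)$,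 with norm $\|u\|_{L^p(\Omega)}+\|\nabla u\|_{L^p(\Omega)}$, and, for $s\in(0,1)$, let $W_0^{s,p}(\Omega)$ be the closure of $C_c^\infty(\Omega)$ (functions being extended by zero outside $\Omega$) in $W^{s,p}(\mathbb R^N)$, with norm $\|u\|_{L^p(\mathbb R^N)}+[u]_{s,p}$. Then the elements of $\mathcal X_\mu(\Omega)$ are identified with (classes of) measurable functions on $\Omega$, by an injective linear map that extends the inclusion of $C_c^\infty(\Omega)$, in such a way that the following holds. (a) Let $(s_\sharp,p_\sharp)\in[\overline s,1]\times[\overline p,N)$ be such that $\mu^+([s_\sharp,1]\times[p_\sharp,N))>0$. - If $s_\sharp=1$, there exists $C=C(p_\sharp,N,\Omega,\mu^+)>0$ such that every $u\in\mathcal X_\mu(\Omega)$ belongs to $W_0^{1,p_\sharp}(\Omega)$ and $\|u\|_{W_0^{1,p_\sharp}(\Omega)}\le C\|u\|_\mu$; that is, $\mathcal X_\mu(\Omega)$ is continuously embedded in $W_0^{1,p_\sharp}(\Omega)$. - If $s_\sharp<1$, set $(p_\sharp)^*_{s_\sharp}:=\frac{Np_\sharp}{N-s_\sharp p_\sharp}$.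 There exists $C=C(s_\sharp,p_\sharp,N,\Omega,\mu^+)>0$ such that every $u\in\mathcal X_\mu(\Omega)$ belongs to $L^{(p_\sharp)^*_{s_\sharp}}(\Omega)$ and $\|u\|_{L^{(p_\sharp)^*_{s_\sharp}}(\Omega)}\le C\|u\|_\mu$; that is, $\mathcal X_\mu(\Omega)$ is continuously embedded in $L^{(p_\sharp)^*_{s_\sharp}}(\Omega)$. (b) If $(s_1,p_1)\in(0,1)\times(1,N)$ satisfies $\mu^+([s_1,1)\times\{p_1\})>0$, there exists $C=C(s_1,p_1,N,\Omega,\mu^+)>0$ such that every $u\in\mathcal X_\mu(\Omega)$ belongs to $W_0^{s_1,p_1}(\Omega)$ and $\|u\|_{W_0^{s_1,p_1}(\Omega)}\le C\|u\|_\mu$; that is, $\mathcal X_\mu(\Omega)$ is continuously embedded in $W_0^{s_1,p_1}(\Omega)$. -/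

import Mathlib

open MeasureTheory Set TopologicalSpace
open scoped ENNReal Distributions

noncomputable section

namespace FracSuperposition

/-- The Euclidean space `ℝ^N`. -/
abbrev Eu (N : ℕ) : Type := EuclideanSpace ℝ (Fin N)

/-- The parameter set `Σ = [0,1] × (1,N)`, with points `(s, p)`. -/
def Sig (N : ℕ) : Set (ℝ × ℝ) := Icc 0 1 ×ˢ Ioo 1 (N : ℝ)

/-- The normalizing constant `c_{N,s,p}`. -/
def fracConst (N : ℕ) (s p : ℝ) : ℝ :=
  s * 2 ^ (2 * s) * Real.Gamma ((p * s + p + N - 2) / 2) /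
    (Real.pi ^ ((N : ℝ) / 2) * Real.Gamma (1 - s))

/-- The normalized Gagliardo seminorm `[u]_{s,p}` for `s ∈ (0,1)`, as an extended real. -/
def gagliardo (N : ℕ) (s p : ℝ) (u : Eu N → ℝ) : ℝ≥0∞ :=
  (ENNReal.ofReal (fracConst N s p) *
    ∫⁻ z : Eu N × Eu N,
      ENNReal.ofReal (|u z.1 - u z.2| ^ p / ‖z.1 - z.2‖ ^ (N + s * p))) ^ (1 / p)

/-- The seminorm `[u]_{s,p}` for `s ∈ [0,1]` and a differentiable function `u` on `ℝ^N`
(it is only used for test functions; at `s = 1` the gradient is the classical one). -/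
def semi (N : ℕ) (s p : ℝ) (u : Eu N → ℝ) : ℝ≥0∞ :=
  if s = 0 then eLpNorm u (ENNReal.ofReal p) volume
  else if s = 1 then eLpNorm (gradient u) (ENNReal.ofReal p) volume
  else gagliardo N s p u

/-- `‖u‖_μ = ∬_Σ [u]_{s,p} dμ(s,p)`. -/
def muNorm {N : ℕ} (μ : Measure (ℝ × ℝ)) (u : Eu N → ℝ) : ℝ≥0∞ :=
  ∫⁻ z in Sig N, semi N z.1 z.2 u ∂μ

/-! ### `‖·‖_μ` is a finite seminorm on test functions -/

section Helpers

variable {N : ℕ} {Ω : Opens (Eu N)}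

theorem contDiff_one (u : 𝓓(Ω, ℝ)) : ContDiff ℝ 1 u := u.contDiff.of_le (by exact_mod_cast le_top)

theorem gradient_add (u v : 𝓓(Ω, ℝ)) : gradient (u + v : Eu N → ℝ) = gradient u + gradient v := by
  funext x
  have hu : DifferentiableAt ℝ u x := (contDiff_one u).differentiable (by simp) x
  have hv : DifferentiableAt ℝ v x := (contDiff_one v).differentiable (by simp) x
  simp [gradient, fderiv_add hu hv]

theorem gradient_smul (c : ℝ) (u : 𝓓(Ω, ℝ)) : gradient (c • u : Eu N → ℝ) = c • gradient u := by
  funext x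
  have hu : DifferentiableAt ℝ u x := (contDiff_one u).differentiable (by simp) x
  simp [gradient, fderiv_const_smul hu]

theorem continuous_gradient (u : 𝓓(Ω, ℝ)) : Continuous (gradient u) := by
  have := (contDiff_one u).continuous_fderiv (by simp)
  unfold gradient
  fun_prop

theorem norm_gradient (u : Eu N → ℝ) (x : Eu N) : ‖gradient u x‖ = ‖fderiv ℝ u x‖ := by
  simp [gradient]

theorem gagliardo_integrand_eq {s p : ℝ} (hp : 1 < p) (u : Eu N → ℝ) (z : Eu N × Eu N) :
    ENNReal.ofReal (|u z.1 - u z.2| ^ p / ‖z.1 - z.2‖ ^ (N + s * p)) =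
      ENNReal.ofReal (|u z.1 - u z.2| / ‖z.1 - z.2‖ ^ ((N + s * p) / p)) ^ p := by
  rw [ENNReal.ofReal_rpow_of_nonneg (by positivity) (by linarith),
    Real.div_rpow (by positivity) (by positivity), ← Real.rpow_mul (by positivity),
    div_mul_cancel₀ _ (by linarith)]

theorem gagliardo_add {s p : ℝ} (hp : 1 < p) {u v : Eu N → ℝ} (hu : Measurable u)
    (hv : Measurable v) :
    gagliardo N s p (u + v) ≤ gagliardo N s p u + gagliardo N s p v := by
  unfold gagliardo
  have h0 : (0 : ℝ) ≤ 1 / p := by positivity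
  simp only [gagliardo_integrand_eq hp, ENNReal.mul_rpow_of_nonneg _ _ h0, ← mul_add]
  gcongr
  refine le_trans ?_ (ENNReal.lintegral_Lp_add_le (by fun_prop) (by fun_prop) hp.le)
  gcongr with z
  simp only [Pi.add_apply]
  rw [← ENNReal.ofReal_add (by positivity) (by positivity), ← add_div]
  gcongr
  rw [add_sub_add_comm]
  exact abs_add_le _ _

theorem gagliardo_smul {s p : ℝ} (hp : 1 < p) (c : ℝ) (u : Eu N → ℝ) :
    gagliardo N s p (c • u) = ENNReal.ofReal |c| * gagliardo N s p u := by
  unfold gagliardo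
  have h0 : (0 : ℝ) ≤ 1 / p := by positivity
  have : ∀ z : Eu N × Eu N,
      ENNReal.ofReal (|(c • u) z.1 - (c • u) z.2| ^ p / ‖z.1 - z.2‖ ^ (N + s * p)) =
      ENNReal.ofReal |c| ^ p * ENNReal.ofReal (|u z.1 - u z.2| ^ p / ‖z.1 - z.2‖ ^ (N + s * p)) := by
    intro z
    rw [ENNReal.ofReal_rpow_of_nonneg (by positivity) (by linarith),
      ← ENNReal.ofReal_mul (by positivity)]
    simp only [Pi.smul_apply, smul_eq_mul, ← mul_sub, abs_mul]
    rw [Real.mul_rpow (by positivity) (by positivity), mul_div_assoc]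
  simp only [this]
  rw [lintegral_const_mul' _ _ (ENNReal.rpow_ne_top_of_nonneg (by linarith) (by simp)),
    mul_left_comm, ENNReal.mul_rpow_of_nonneg _ _ h0, ← ENNReal.rpow_mul,
    mul_one_div_cancel (by linarith), ENNReal.rpow_one]

theorem semi_add {s p : ℝ} (hp : 1 < p) (u v : 𝓓(Ω, ℝ)) :
    semi N s p (u + v : Eu N → ℝ) ≤ semi N s p u + semi N s p v := by
  have hp' : 1 ≤ ENNReal.ofReal p := by simpa using hp.le
  unfold semi
  split_ifs
  · exact eLpNorm_add_le u.continuous.aestronglyMeasurable v.continuous.aestronglyMeasurable hp'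
  · rw [gradient_add]
    exact eLpNorm_add_le (continuous_gradient u).aestronglyMeasurable
      (continuous_gradient v).aestronglyMeasurable hp'
  · exact gagliardo_add hp u.continuous.measurable v.continuous.measurable

theorem semi_smul {s p : ℝ} (hp : 1 < p) (c : ℝ) (u : 𝓓(Ω, ℝ)) :
    semi N s p (c • u : Eu N → ℝ) = ENNReal.ofReal |c| * semi N s p u := by
  unfold semi
  split_ifs
  · rw [eLpNorm_const_smul]; simp [← ofReal_norm]
  · rw [gradient_smul, eLpNorm_const_smul]; simp [← ofReal_norm]
  · exact gagliardo_smul hp c u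

theorem continuousAt_Gamma {x : ℝ} (hx : 0 < x) : ContinuousAt Real.Gamma x :=
  (Real.differentiableAt_Gamma fun m => by
    have : (0 : ℝ) ≤ m := m.cast_nonneg
    linarith).continuousAt

theorem two_le_of_mem {p : ℝ} (h1 : 1 < p) (h2 : p < N) : (2 : ℝ) ≤ N := by
  have : 1 < N := by exact_mod_cast h1.trans h2
  exact_mod_cast this

theorem continuousOn_fracConst : ContinuousOn (fun z : ℝ × ℝ => fracConst N z.1 z.2)
    (Ioo 0 1 ×ˢ Ioo 1 (N : ℝ)) := by
  rintro ⟨s, p⟩ ⟨⟨hs0, hs1⟩, hp1, hpN⟩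
  apply ContinuousAt.continuousWithinAt
  have hN := two_le_of_mem hp1 hpN
  dsimp only at hs0 hs1 hp1 hpN
  have hps : 0 < p * s := by positivity
  have h1 : ContinuousAt (fun z : ℝ × ℝ => Real.Gamma ((z.2 * z.1 + z.2 + N - 2) / 2)) (s, p) :=
    ContinuousAt.comp (f := fun z : ℝ × ℝ => (z.2 * z.1 + z.2 + N - 2) / 2)
      (continuousAt_Gamma (by dsimp only; linarith)) (by fun_prop)
  have h2 : ContinuousAt (fun z : ℝ × ℝ => Real.Gamma (1 - z.1)) (s, p) :=
    ContinuousAt.comp (f := fun z : ℝ × ℝ => 1 - z.1)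
      (continuousAt_Gamma (by dsimp only; linarith)) (by fun_prop)
  have h3 : ContinuousAt (fun z : ℝ × ℝ => (2 : ℝ) ^ (2 * z.1)) (s, p) :=
    ContinuousAt.rpow (by fun_prop) (by fun_prop) (by simp)
  unfold fracConst
  refine ContinuousAt.div (by fun_prop) (by fun_prop) ?_
  have : 0 < Real.Gamma (1 - s) := Real.Gamma_pos_of_pos (by linarith)
  positivity

theorem aemeasurable_semi (μ : Measure (ℝ × ℝ)) (u : 𝓓(Ω, ℝ)) :
    AEMeasurable (fun z : ℝ × ℝ => semi N z.1 z.2 u) (μ.restrict (Sig N)) := by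
  have hu := u.continuous.measurable
  have hg := (continuous_gradient u).measurable
  have hsplit : Sig N = ({0} ×ˢ Ioo 1 (N : ℝ) ∪ {1} ×ˢ Ioo 1 (N : ℝ)) ∪
      Ioo 0 1 ×ˢ Ioo 1 (N : ℝ) := by
    rw [← union_prod, ← union_prod, Sig]
    congr 1
    ext s
    simp only [mem_Icc, mem_union, mem_singleton_iff, mem_Ioo]
    constructor
    · rintro ⟨h0, h1⟩
      rcases h0.eq_or_lt with h | h
      · exact Or.inl (Or.inl h.symm)
      rcases h1.eq_or_lt with h' | h'
      · exact Or.inl (Or.inr h')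
      exact Or.inr ⟨h, h'⟩
    · rintro ((rfl | rfl) | ⟨h, h'⟩)
      · simp
      · simp
      · exact ⟨h.le, h'.le⟩
  have key : ∀ {F : Type} [NormedAddCommGroup F] [MeasurableSpace F] [BorelSpace F]
      (f : Eu N → F), Measurable f → ∀ (t : Set ℝ), MeasurableSet t →
      AEMeasurable (fun z : ℝ × ℝ => eLpNorm f (ENNReal.ofReal z.2) volume)
        (μ.restrict (t ×ˢ Ioo 1 (N : ℝ))) := by
    intro F _ _ _ f hf t ht
    have hm : Measurable fun z : ℝ × ℝ => (∫⁻ x, ‖f x‖ₑ ^ z.2) ^ (1 / z.2) := by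
      refine Measurable.pow (Measurable.lintegral_prod_right' (f := fun q : (ℝ × ℝ) × Eu N =>
        ‖f q.2‖ₑ ^ q.1.2) ?_) (by fun_prop)
      exact Measurable.pow (by fun_prop) (by fun_prop)
    refine hm.aemeasurable.congr ?_
    filter_upwards [ae_restrict_mem (ht.prod measurableSet_Ioo)] with z hz
    have hz1 : 1 < z.2 := hz.2.1
    rw [eLpNorm_eq_lintegral_rpow_enorm_toReal (by simp; linarith) (by simp),
      ENNReal.toReal_ofReal (by linarith)]
  rw [hsplit, aemeasurable_union_iff, aemeasurable_union_iff]
  refine ⟨⟨?_, ?_⟩, ?_⟩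
  · refine (key u hu _ (measurableSet_singleton 0)).congr ?_
    filter_upwards [ae_restrict_mem ((measurableSet_singleton 0).prod measurableSet_Ioo)] with z hz
    have : z.1 = 0 := hz.1
    simp [semi, this]
  · refine (key _ hg _ (measurableSet_singleton 1)).congr ?_
    filter_upwards [ae_restrict_mem ((measurableSet_singleton 1).prod measurableSet_Ioo)] with z hz
    have : z.1 = 1 := hz.1
    simp [semi, this]
  · have hS : MeasurableSet (Ioo (0 : ℝ) 1 ×ˢ Ioo 1 (N : ℝ)) :=
      measurableSet_Ioo.prod measurableSet_Ioo
    have hc := (continuousOn_fracConst (N := N)).aemeasurable (μ := μ) hS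
    have hm : Measurable fun z : ℝ × ℝ => ∫⁻ w : Eu N × Eu N,
        ENNReal.ofReal (|u w.1 - u w.2| ^ z.2 / ‖w.1 - w.2‖ ^ (N + z.1 * z.2)) := by
      refine Measurable.lintegral_prod_right' (f := fun q : (ℝ × ℝ) × (Eu N × Eu N) =>
        ENNReal.ofReal (|u q.2.1 - u q.2.2| ^ q.1.2 / ‖q.2.1 - q.2.2‖ ^ (N + q.1.1 * q.1.2))) ?_
      refine ENNReal.measurable_ofReal.comp (Measurable.div ?_ ?_)
      · refine Measurable.pow ?_ (by fun_prop)
        exact ((hu.comp (by fun_prop)).sub (hu.comp (by fun_prop))).abs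
      · exact Measurable.pow (by fun_prop) (by fun_prop)
    refine ((hc.ennreal_ofReal.mul hm.aemeasurable).pow
      (g := fun z : ℝ × ℝ => 1 / z.2) (by fun_prop)).congr ?_
    filter_upwards [ae_restrict_mem hS] with z hz
    have h0 : z.1 ≠ 0 := hz.1.1.ne'
    have h1 : z.1 ≠ 1 := hz.1.2.ne
    simp [semi, h0, h1, gagliardo]

theorem fracConst_le : ∃ K : ℝ, 0 ≤ K ∧ ∀ s p : ℝ, 0 < s → s < 1 → 1 < p → p < N →
    fracConst N s p ≤ K * (s * (1 - s)) := by
  obtain ⟨M, hM⟩ := (isCompact_Icc (a := (1 / 2 : ℝ)) (b := 3 * N / 2)).bddAbove_image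
    (f := Real.Gamma) fun x hx => (continuousAt_Gamma (by linarith [hx.1])).continuousWithinAt
  obtain ⟨x₀, hx₀, hmin⟩ := (isCompact_Icc (a := (1 : ℝ)) (b := 2)).exists_isMinOn
    (by simp) (f := Real.Gamma)
    fun x hx => (continuousAt_Gamma (by linarith [hx.1])).continuousWithinAt
  have hm : 0 < Real.Gamma x₀ := Real.Gamma_pos_of_pos (by linarith [hx₀.1])
  set m := Real.Gamma x₀
  refine ⟨4 * |M| / (Real.pi ^ ((N : ℝ) / 2) * m), by positivity, fun s p hs0 hs1 hp1 hpN => ?_⟩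
  have hN := two_le_of_mem hp1 hpN
  have hps : 0 < p * s := by positivity
  have hps' : p * s < p := by nlinarith
  have hG1 : Real.Gamma ((p * s + p + N - 2) / 2) ≤ |M| :=
    (hM ⟨_, ⟨by linarith, by linarith⟩, rfl⟩).trans (le_abs_self M)
  have hG2 : m ≤ Real.Gamma (2 - s) := hmin ⟨by linarith, by linarith⟩
  have hG3 : Real.Gamma (2 - s) = (1 - s) * Real.Gamma (1 - s) := by
    rw [← Real.Gamma_add_one (by linarith)]; congr 1; ring
  have hG4 : 0 < Real.Gamma (1 - s) := Real.Gamma_pos_of_pos (by linarith)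
  have h4 : (2 : ℝ) ^ (2 * s) ≤ 4 := by
    calc (2 : ℝ) ^ (2 * s) ≤ 2 ^ (2 : ℝ) := Real.rpow_le_rpow_of_exponent_le (by norm_num) (by linarith)
      _ = 4 := by norm_num
  have h1s : 0 < 1 - s := by linarith
  have e : fracConst N s p = (2 ^ (2 * s) * Real.Gamma ((p * s + p + N - 2) / 2) /
      (Real.pi ^ ((N : ℝ) / 2) * Real.Gamma (2 - s))) * (s * (1 - s)) := by
    rw [hG3, fracConst]
    field_simp
  have hG5 : 0 ≤ Real.Gamma ((p * s + p + N - 2) / 2) :=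
    (Real.Gamma_pos_of_pos (by linarith)).le
  rw [e]
  gcongr

/-- Radial integral in polar coordinates. -/
theorem lintegral_radial (hN : 1 ≤ N) {s p : ℝ} (hs0 : 0 < s) (hs1 : s < 1) (hp1 : 1 < p) :
    ∫⁻ x : Eu N, ENNReal.ofReal (min ‖x‖ 1 ^ p / ‖x‖ ^ (N + s * p)) =
      ENNReal.ofReal (N * volume.real (Metric.ball (0 : Eu N) 1) / (p * (s * (1 - s)))) := by
  have : Nonempty (Fin N) := ⟨⟨0, hN⟩⟩
  have hp0 : 0 < p := by linarith
  have hsp : 0 < s * p := by positivity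
  have h1s : 0 < 1 - s := by linarith
  set f : ℝ → ℝ := fun r => min r 1 ^ p / r ^ (N + s * p) with hf
  have e1 : EqOn (fun r : ℝ => r ^ (N - 1) • f r) (fun r => r ^ (p * (1 - s) - 1)) (Ioc 0 1) := by
    intro r hr
    have hr0 : 0 < r := hr.1
    simp only [hf, smul_eq_mul, min_eq_left hr.2]
    rw [← Real.rpow_natCast, ← mul_div_assoc, ← Real.rpow_add hr0, ← Real.rpow_sub hr0,
      Nat.cast_sub hN]
    congr 1; push_cast; ring
  have e2 : EqOn (fun r : ℝ => r ^ (N - 1) • f r) (fun r => r ^ (-1 - s * p)) (Ioi 1) := by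
    intro r hr
    have hr1 : 1 < r := hr
    have hr0 : 0 < r := by linarith
    simp only [hf, smul_eq_mul, min_eq_right hr1.le, Real.one_rpow]
    rw [← Real.rpow_natCast, ← mul_div_assoc, mul_one, ← Real.rpow_sub hr0, Nat.cast_sub hN]
    congr 1; push_cast; ring
  have hlt : -1 < p * (1 - s) - 1 := by nlinarith [mul_pos hp0 h1s]
  have i1 : IntegrableOn (fun r : ℝ => r ^ (N - 1) • f r) (Ioc 0 1) := by
    rw [integrableOn_congr_fun e1 measurableSet_Ioc, ← intervalIntegrable_iff_integrableOn_Ioc_of_le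
      zero_le_one]
    exact intervalIntegral.intervalIntegrable_rpow' hlt
  have i2 : IntegrableOn (fun r : ℝ => r ^ (N - 1) • f r) (Ioi 1) := by
    rw [integrableOn_congr_fun e2 measurableSet_Ioi]
    exact integrableOn_Ioi_rpow_of_lt (by linarith) one_pos
  have hint : ∫ r in Ioi (0 : ℝ), r ^ (N - 1) • f r = 1 / (p * (s * (1 - s))) := by
    rw [← Ioc_union_Ioi_eq_Ioi (zero_le_one (α := ℝ)), setIntegral_union
      (Ioc_disjoint_Ioi le_rfl) measurableSet_Ioi i1 i2, setIntegral_congr_fun measurableSet_Ioc e1,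
      setIntegral_congr_fun measurableSet_Ioi e2, integral_Ioi_rpow_of_lt (by linarith) one_pos,
      ← intervalIntegral.integral_of_le zero_le_one, integral_rpow (Or.inl hlt)]
    have : p * (1 - s) - 1 + 1 = p * (1 - s) := by ring
    rw [this, Real.zero_rpow (by positivity)]
    have : -1 - s * p + 1 = - (s * p) := by ring
    rw [this]
    simp only [Real.one_rpow]
    field_simp
    ring
  have hI : Integrable (fun x : Eu N => f ‖x‖) := by
    rw [integrable_fun_norm_addHaar]
    simp only [finrank_euclideanSpace, Fintype.card_fin]
    rw [← Ioc_union_Ioi_eq_Ioi (zero_le_one (α := ℝ))]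
    exact i1.union i2
  rw [← ofReal_integral_eq_lintegral_ofReal hI
    (ae_of_all _ fun x => by simp only [hf]; positivity), integral_fun_norm_addHaar]
  simp only [finrank_euclideanSpace, Fintype.card_fin]
  rw [hint]
  simp only [nsmul_eq_mul, smul_eq_mul]
  congr 1; ring

theorem semi_bounded (u : 𝓓(Ω, ℝ)) : ∃ B : ℝ≥0∞, B ≠ ∞ ∧ ∀ z ∈ Sig N, semi N z.1 z.2 u ≤ B := by
  obtain ⟨A₁, hA₁⟩ := u.continuous.bounded_above_of_compact_support u.hasCompactSupport
  have hdc := (contDiff_one u).continuous_fderiv (by simp)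
  obtain ⟨A₂, hA₂⟩ := hdc.bounded_above_of_compact_support (u.hasCompactSupport.fderiv (𝕜 := ℝ))
  obtain ⟨K, hK0, hK⟩ := fracConst_le (N := N)
  set A : ℝ := max 1 (max (2 * A₁) A₂) with hA
  have hA1 : 1 ≤ A := le_max_left _ _
  have hAu : ∀ x, ‖u x‖ ≤ A := fun x => (hA₁ x).trans <| by
    have : 0 ≤ A₁ := (norm_nonneg _).trans (hA₁ x)
    exact le_trans (by linarith) ((le_max_left _ _).trans (le_max_right _ _))
  have hAd : ∀ x, ‖fderiv ℝ u x‖ ≤ A := fun x =>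
    (hA₂ x).trans ((le_max_right _ _).trans (le_max_right _ _))
  have hdiff : ∀ x y, |u x - u y| ≤ A * min ‖x - y‖ 1 := by
    intro x y
    rw [mul_min_of_nonneg _ _ (by linarith), mul_one]
    refine le_min ?_ ?_
    · exact Convex.norm_image_sub_le_of_norm_fderiv_le (𝕜 := ℝ) (s := univ)
        (fun z _ => (contDiff_one u).differentiable (by simp) z) (fun z _ => hAd z) convex_univ
        (mem_univ y) (mem_univ x)
    · refine le_trans ?_ ((le_max_left _ _).trans (le_max_right _ _))
      have h1 := hA₁ x
      have h2 := hA₁ y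
      have := norm_sub_le (u x) (u y)
      rw [Real.norm_eq_abs] at this
      linarith
  set V : Set (Eu N) := tsupport u with hV
  have hVc : IsCompact V := u.hasCompactSupport
  have hVm : MeasurableSet V := hVc.measurableSet
  have hVt : volume V ≠ ∞ := hVc.measure_lt_top.ne
  have hu0 : ∀ x ∉ V, u x = 0 := fun x hx => image_eq_zero_of_notMem_tsupport hx
  have hg0 : ∀ x ∉ V, gradient u x = 0 := fun x hx => by
    have : fderiv ℝ u x = 0 := by
      have := support_fderiv_subset ℝ (f := u)
      by_contra h
      exact hx (this h)
    simp [gradient, this]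
  have hroot : ∀ (a : ℝ≥0∞) {p : ℝ}, 1 < p → a ^ (1 / p) ≤ max 1 a := by
    intro a p hp
    rcases le_total a 1 with h | h
    · exact (ENNReal.rpow_le_one h (by positivity)).trans (le_max_left _ _)
    · refine le_trans ?_ (le_max_right _ _)
      calc a ^ (1 / p) ≤ a ^ (1 : ℝ) := ENNReal.rpow_le_rpow_of_exponent_le h (by
            rw [div_le_one (by linarith)]; exact hp.le)
        _ = a := ENNReal.rpow_one a
  have hLp : ∀ {F : Type} [NormedAddCommGroup F] (f : Eu N → F), (∀ x, ‖f x‖ ≤ A) →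
      (∀ x ∉ V, f x = 0) → ∀ p : ℝ, 1 < p →
      eLpNorm f (ENNReal.ofReal p) volume ≤ max 1 (volume V) * ENNReal.ofReal A := by
    intro F _ f hfA hf0 p hp
    rw [← eLpNorm_restrict_eq_of_support_subset (s := V) (fun x hx => by
      by_contra h; exact hx (hf0 x h))]
    refine (eLpNorm_le_of_ae_bound (ae_of_all _ hfA)).trans ?_
    gcongr
    rw [ENNReal.toReal_ofReal (by linarith), Measure.restrict_apply_univ, ← one_div]
    exact hroot _ hp
  set ω : ℝ := volume.real (Metric.ball (0 : Eu N) 1)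
  set B₂ : ℝ≥0∞ := ENNReal.ofReal (K * A ^ (N : ℝ) * (N * ω)) * (2 * volume V) with hB₂
  refine ⟨max (max 1 (volume V) * ENNReal.ofReal A) (max 1 B₂), ?_, ?_⟩
  · have : B₂ ≠ ∞ := by
      rw [hB₂]; exact ENNReal.mul_ne_top ENNReal.ofReal_ne_top (ENNReal.mul_ne_top (by simp) hVt)
    have h' : max 1 (volume V) * ENNReal.ofReal A ≠ ∞ :=
      ENNReal.mul_ne_top (by simp [hVt]) ENNReal.ofReal_ne_top
    simp [this, h']
  rintro ⟨s, p⟩ ⟨⟨hs0, hs1⟩, hp1, hpN⟩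
  dsimp only at hs0 hs1 hp1 hpN ⊢
  unfold semi
  split_ifs with h0 h1
  · exact (hLp u hAu hu0 p hp1).trans (le_max_left _ _)
  · exact (hLp _ (fun x => by rw [norm_gradient]; exact hAd x) hg0 p hp1).trans (le_max_left _ _)
  replace hs0 : 0 < s := lt_of_le_of_ne hs0 (Ne.symm h0)
  replace hs1 : s < 1 := lt_of_le_of_ne hs1 h1
  have hN1 : 1 ≤ N := by
    have := two_le_of_mem hp1 hpN
    have : (1 : ℝ) ≤ N := by linarith
    exact_mod_cast this
  refine le_trans ?_ (le_max_right _ _)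
  refine (hroot _ hp1).trans (max_le_max le_rfl ?_)
  set G : Eu N → ℝ≥0∞ := fun x => ENNReal.ofReal (min ‖x‖ 1 ^ p / ‖x‖ ^ (N + s * p)) with hG
  have hGm : Measurable G := by
    refine ENNReal.measurable_ofReal.comp (Measurable.div ?_ ?_)
    · exact Measurable.pow (by fun_prop) (by fun_prop)
    · exact Measurable.pow (by fun_prop) (by fun_prop)
  have hpt : ∀ z : Eu N × Eu N,
      ENNReal.ofReal (|u z.1 - u z.2| ^ p / ‖z.1 - z.2‖ ^ (N + s * p)) ≤
        ENNReal.ofReal (A ^ (N : ℝ)) * (V.indicator 1 z.1 * G (z.1 - z.2) +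
          V.indicator 1 z.2 * G (z.1 - z.2)) := by
    intro z
    by_cases hz : z.1 ∈ V ∨ z.2 ∈ V
    · have hone : (1 : ℝ≥0∞) ≤ V.indicator 1 z.1 + V.indicator 1 z.2 := by
        rcases hz with hz | hz <;> simp [hz]
      rw [← add_mul]
      calc _ ≤ ENNReal.ofReal (A ^ (N : ℝ)) * (1 * G (z.1 - z.2)) := by
            rw [one_mul, hG, ← ENNReal.ofReal_mul (by positivity), ← mul_div_assoc]
            apply ENNReal.ofReal_le_ofReal
            gcongr
            calc |u z.1 - u z.2| ^ p ≤ (A * min ‖z.1 - z.2‖ 1) ^ p := by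
                  gcongr; exact hdiff _ _
              _ = A ^ p * min ‖z.1 - z.2‖ 1 ^ p := Real.mul_rpow (by positivity) (by positivity)
              _ ≤ A ^ (N : ℝ) * min ‖z.1 - z.2‖ 1 ^ p := by
                  gcongr
        _ ≤ _ := by gcongr
    · push Not at hz
      rw [hu0 _ hz.1, hu0 _ hz.2]
      simp [Real.zero_rpow (by linarith : p ≠ 0)]
  have hGint := lintegral_radial hN1 hs0 hs1 hp1
  have hI1 : ∫⁻ z : Eu N × Eu N, V.indicator 1 z.1 * G (z.1 - z.2) = volume V * ∫⁻ x, G x := by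
    rw [Measure.volume_eq_prod, lintegral_prod _ (by
      refine Measurable.aemeasurable (Measurable.mul ?_ (hGm.comp (by fun_prop)))
      exact (measurable_one.indicator hVm).comp measurable_fst)]
    have : ∀ x : Eu N, ∫⁻ y, V.indicator 1 x * G (x - y) = V.indicator 1 x * ∫⁻ y, G y := by
      intro x
      rw [lintegral_const_mul _ (by fun_prop), lintegral_sub_left_eq_self G x]
    simp only [this]
    rw [lintegral_mul_const _ (measurable_one.indicator hVm), lintegral_indicator_one hVm]
  have hI2 : ∫⁻ z : Eu N × Eu N, V.indicator 1 z.2 * G (z.1 - z.2) = volume V * ∫⁻ x, G x := by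
    rw [Measure.volume_eq_prod, lintegral_prod_symm _ (by
      refine Measurable.aemeasurable (Measurable.mul ?_ (hGm.comp (by fun_prop)))
      exact (measurable_one.indicator hVm).comp measurable_snd)]
    have : ∀ y : Eu N, ∫⁻ x, V.indicator 1 y * G (x - y) = V.indicator 1 y * ∫⁻ x, G x := by
      intro y
      rw [lintegral_const_mul _ (by fun_prop), lintegral_sub_right_eq_self G y]
    simp only [this]
    rw [lintegral_mul_const _ (measurable_one.indicator hVm), lintegral_indicator_one hVm]
  have hω : 0 ≤ ω := measureReal_nonneg
  have hss : 0 < s * (1 - s) := mul_pos hs0 (by linarith)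
  calc _ ≤ ENNReal.ofReal (K * (s * (1 - s))) * ∫⁻ z : Eu N × Eu N,
        ENNReal.ofReal (A ^ (N : ℝ)) * (V.indicator 1 z.1 * G (z.1 - z.2) +
          V.indicator 1 z.2 * G (z.1 - z.2)) := by
        gcongr with z
        · exact hK s p hs0 hs1 hp1 hpN
        · exact hpt z
    _ = ENNReal.ofReal (K * (s * (1 - s))) * (ENNReal.ofReal (A ^ (N : ℝ)) *
          (volume V * (∫⁻ x, G x) + volume V * (∫⁻ x, G x))) := by
        rw [lintegral_const_mul' _ _ ENNReal.ofReal_ne_top, lintegral_add_left, hI1, hI2]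
        exact ((measurable_one.indicator hVm).comp measurable_fst).mul (by fun_prop)
    _ = ENNReal.ofReal (K * (s * (1 - s))) * ENNReal.ofReal (A ^ (N : ℝ)) *
          ENNReal.ofReal (N * ω / (p * (s * (1 - s)))) * (2 * volume V) := by
        rw [hG, hGint]; ring
    _ ≤ B₂ := by
        rw [hB₂]
        gcongr
        rw [← ENNReal.ofReal_mul (by positivity), ← ENNReal.ofReal_mul (by positivity)]
        apply ENNReal.ofReal_le_ofReal
        have : K * (s * (1 - s)) * A ^ (N : ℝ) * (N * ω / (p * (s * (1 - s)))) =
          K * A ^ (N : ℝ) * (N * ω) / p := by field_simp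
        rw [this]
        exact div_le_self (by positivity) hp1.le

theorem muNorm_ne_top (μ : Measure (ℝ × ℝ)) [IsFiniteMeasure μ] (u : 𝓓(Ω, ℝ)) :
    muNorm μ (u : Eu N → ℝ) ≠ ∞ := by
  obtain ⟨B, hB, hBz⟩ := semi_bounded u
  have hS : MeasurableSet (Sig N) := measurableSet_Icc.prod measurableSet_Ioo
  refine ne_top_of_le_ne_top ?_ (setLIntegral_mono' hS hBz)
  simpa using ENNReal.mul_ne_top hB (measure_ne_top μ _)

theorem muNorm_add (μ : Measure (ℝ × ℝ)) (u v : 𝓓(Ω, ℝ)) :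
    muNorm μ (u + v : Eu N → ℝ) ≤ muNorm μ (u : Eu N → ℝ) + muNorm μ (v : Eu N → ℝ) := by
  unfold muNorm
  rw [← lintegral_add_left' (aemeasurable_semi μ u)]
  exact setLIntegral_mono' (measurableSet_Icc.prod measurableSet_Ioo)
    fun z hz => semi_add hz.2.1 u v

theorem muNorm_smul (μ : Measure (ℝ × ℝ)) (c : ℝ) (u : 𝓓(Ω, ℝ)) :
    muNorm μ (c • u : Eu N → ℝ) = ENNReal.ofReal |c| * muNorm μ (u : Eu N → ℝ) := by
  unfold muNorm
  rw [← lintegral_const_mul' _ _ ENNReal.ofReal_ne_top]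
  exact setLIntegral_congr_fun (measurableSet_Icc.prod measurableSet_Ioo)
    fun z hz => semi_smul hz.2.1 c u

end Helpers

/-! ### The space `X_μ(Ω)` -/

/-- `C_c^∞(Ω)`, to be equipped with `‖·‖_μ` instead of its usual topology. -/
def PreX {N : ℕ} (_μ : Measure (ℝ × ℝ)) (Ω : Opens (Eu N)) : Type := 𝓓(Ω, ℝ)

instance instAddCommGroupPreX {N : ℕ} (μ : Measure (ℝ × ℝ)) (Ω : Opens (Eu N)) :
    AddCommGroup (PreX μ Ω) :=
  inferInstanceAs (AddCommGroup 𝓓(Ω, ℝ))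

instance instModulePreX {N : ℕ} (μ : Measure (ℝ × ℝ)) (Ω : Opens (Eu N)) :
    Module ℝ (PreX μ Ω) :=
  inferInstanceAs (Module ℝ 𝓓(Ω, ℝ))

/-- `‖·‖_μ` as a seminorm on `C_c^∞(Ω)`. -/
def muSeminorm {N : ℕ} (μ : Measure (ℝ × ℝ)) [IsFiniteMeasure μ] (Ω : Opens (Eu N)) :
    Seminorm ℝ 𝓓(Ω, ℝ) :=
  Seminorm.of (fun u => (muNorm μ (u : Eu N → ℝ)).toReal)
    (fun u v => by
      rw [← ENNReal.toReal_add (muNorm_ne_top μ u) (muNorm_ne_top μ v)]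
      exact ENNReal.toReal_mono
        (ENNReal.add_ne_top.2 ⟨muNorm_ne_top μ u, muNorm_ne_top μ v⟩) (muNorm_add μ u v))
    (fun c u => by
      have h : (muNorm μ ((c • u : 𝓓(Ω, ℝ)) : Eu N → ℝ)) = _ := muNorm_smul μ c u
      rw [h, ENNReal.toReal_mul, ENNReal.toReal_ofReal (abs_nonneg c), Real.norm_eq_abs])

instance instSeminormedPreX {N : ℕ} (μ : Measure (ℝ × ℝ)) [IsFiniteMeasure μ]
    (Ω : Opens (Eu N)) : SeminormedAddCommGroup (PreX μ Ω) :=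
  AddGroupSeminorm.toSeminormedAddCommGroup (muSeminorm μ Ω).toAddGroupSeminorm

instance instNormedSpacePreX {N : ℕ} (μ : Measure (ℝ × ℝ)) [IsFiniteMeasure μ]
    (Ω : Opens (Eu N)) : NormedSpace ℝ (PreX μ Ω) where
  norm_smul_le c u := (map_smul_eq_mul (muSeminorm μ Ω) c u).le

/-- `X_μ(Ω)`, the completion of `C_c^∞(Ω)` with respect to `‖·‖_μ`. Its norm is the extension of
`‖·‖_μ`. -/
abbrev X {N : ℕ} (μ : Measure (ℝ × ℝ)) [IsFiniteMeasure μ] (Ω : Opens (Eu N)) : Type :=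
  UniformSpace.Completion (PreX μ Ω)

/-- The canonical map `C_c^∞(Ω) → X_μ(Ω)`. -/
def toX {N : ℕ} (μ : Measure (ℝ × ℝ)) [IsFiniteMeasure μ] {Ω : Opens (Eu N)} (φ : 𝓓(Ω, ℝ)) :
    X μ Ω :=
  ((show PreX μ Ω from φ : PreX μ Ω) : UniformSpace.Completion (PreX μ Ω))

theorem norm_toX {N : ℕ} (μ : Measure (ℝ × ℝ)) [IsFiniteMeasure μ] {Ω : Opens (Eu N)}
    (φ : 𝓓(Ω, ℝ)) : ENNReal.ofReal ‖toX μ φ‖ = muNorm μ (φ : Eu N → ℝ) := by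
  have h : ‖toX μ φ‖ = (muNorm μ (φ : Eu N → ℝ)).toReal := UniformSpace.Completion.norm_coe _
  rw [h, ENNReal.ofReal_toReal (muNorm_ne_top μ φ)]

/-! ### Sobolev spaces with zero boundary values -/

/-- `g` is the weak gradient of `f` in `Ω`. -/
def HasWeakGradient {N : ℕ} (Ω : Opens (Eu N)) (f : Eu N → ℝ) (g : Eu N → Eu N) : Prop :=
  LocallyIntegrableOn f (Ω : Set (Eu N)) ∧ LocallyIntegrableOn g (Ω : Set (Eu N)) ∧
    ∀ φ : 𝓓(Ω, ℝ), ∫ x in (Ω : Set (Eu N)), f x • gradient φ x =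
      -∫ x in (Ω : Set (Eu N)), φ x • g x

/-- The norm `‖f‖_{L^p(Ω)} + ‖∇f‖_{L^p(Ω)}` of `W^{1,p}(Ω)`, where `∇f` is the (a.e. unique) weak
gradient; it is `∞` if there is none. -/
def sobolevNorm {N : ℕ} (Ω : Opens (Eu N)) (p : ℝ) (f : Eu N → ℝ) : ℝ≥0∞ :=
  eLpNorm f (ENNReal.ofReal p) (volume.restrict (Ω : Set (Eu N))) +
    ⨅ (g : Eu N → Eu N) (_ : HasWeakGradient Ω f g),
      eLpNorm g (ENNReal.ofReal p) (volume.restrict (Ω : Set (Eu N)))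

/-- Classes of measurable functions on `Ω` up to equality a.e. -/
abbrev MeasFun {N : ℕ} (Ω : Opens (Eu N)) : Type :=
  Eu N →ₘ[volume.restrict (Ω : Set (Eu N))] ℝ

/-- `W_0^{1,p}(Ω)`: the closure of `C_c^∞(Ω)` in `W^{1,p}(Ω)`. -/
def W01 {N : ℕ} (Ω : Opens (Eu N)) (p : ℝ) : Set (MeasFun Ω) :=
  {f | ∀ ε : ℝ≥0∞, 0 < ε → ∃ φ : 𝓓(Ω, ℝ), sobolevNorm Ω p (fun x => f x - φ x) < ε}

/-- The norm `‖f‖_{L^p(ℝ^N)} + [f]_{s,p}` of `W^{s,p}(ℝ^N)`, for `s ∈ (0,1)`. -/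
def fracSobolevNorm {N : ℕ} (s p : ℝ) (f : Eu N → ℝ) : ℝ≥0∞ :=
  eLpNorm f (ENNReal.ofReal p) volume + gagliardo N s p f

/-- The extension by zero outside `Ω` of a function on `Ω`. -/
def zeroExt {N : ℕ} {Ω : Opens (Eu N)} (f : MeasFun Ω) : Eu N → ℝ :=
  (Ω : Set (Eu N)).indicator f

/-- `W_0^{s,p}(Ω)` for `s ∈ (0,1)`: the functions on `Ω` whose extension by zero is in the closure
of `C_c^∞(Ω)` in `W^{s,p}(ℝ^N)`. -/
def W0s {N : ℕ} (Ω : Opens (Eu N)) (s p : ℝ) : Set (MeasFun Ω) :=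
  {f | ∀ ε : ℝ≥0∞, 0 < ε → ∃ φ : 𝓓(Ω, ℝ), fracSobolevNorm s p (fun x => zeroExt f x - φ x) < ε}

end FracSuperposition

end

open MeasureTheory Set TopologicalSpace
open scoped ENNReal Distributions

noncomputable section

namespace FracSuperposition

open Filter Topology
open scoped NNReal

variable {N : ℕ}

/-! ### The fractional Sobolev inequality -/

/-! Everything reduces to estimates on test functions with `muNorm` on the right. For a single pair
`(σ, q)`, Sobolev's inequality bounds the critical norm by `[·]_{σ,q}`, and Hölder on the bounded
set `Ω` lowers the exponent to that of a pair `(s, p)` with `s ≤ σ`, `p ≤ q`. The constants may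
degenerate as `(σ, q)` varies, but only finitely large constants occur at each pair, so one integer
constant serves on a subset of positive (outer) measure; Markov's inequality there turns the
pointwise estimates into one by `‖·‖_μ` (`exists_le_muNorm`). The gradient and Gagliardo bounds are
obtained in the same way, the latter with `q = p` fixed.

In particular `‖·‖_μ` dominates the `L¹` norm, so the inclusion of test functions extends to a
continuous map from the completion to `L¹(Ω)`. Its injectivity is a closability statement: a
`‖·‖_μ`-Cauchy sequence tending to zero in `L¹` must tend to zero in `‖·‖_μ`. The route is the
inequality `[φ₀] ≤ ∑ [φ_m - φ_{m+1}]` for test functions tending to zero in `L¹` and a.e.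
(`semi_le_tsum`), proved at each `(s, p)` by Fatou or, at `s = 1`, by uniqueness of weak gradients.
It involves no choice depending on `(s, p)`, so it can be integrated in `μ` and then applied to the
tails of a rapidly convergent sequence.

Finally each `u` is approximated by test functions at a geometric rate relative to `‖u‖`
(`IsApprox`). Fatou and completeness of `L^p` carry the test function estimates to the limit, and
the same estimates for differences place the limit in the closures `W01` and `W0s`. -/

/-- The fractional Sobolev conjugate exponent `p*_s`. -/
def critExp (N : ℕ) (s p : ℝ) : ℝ := N * p / (N - s * p)

theorem fracConst_pos (hN : 1 ≤ N) {s p : ℝ} (hs0 : 0 < s) (hs1 : s < 1) (hp1 : 1 < p) :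
    0 < fracConst N s p := by
  have hN' : (1 : ℝ) ≤ N := by exact_mod_cast hN
  have hps : 0 < p * s := by positivity
  have h1 : 0 < Real.Gamma ((p * s + p + N - 2) / 2) := Real.Gamma_pos_of_pos (by linarith)
  have h2 : 0 < Real.Gamma (1 - s) := Real.Gamma_pos_of_pos (by linarith)
  unfold fracConst
  positivity

/-- The inner integral of the Gagliardo seminorm controls `|u(x)|` to the critical power. -/
theorem fracSobolev_pointwise (hN : 1 ≤ N) {s p : ℝ} (hs0 : 0 < s) (hp0 : 0 < p)
    (hsp : s * p < N) {u : Eu N → ℝ} (hu : Measurable u) {k : ℝ} (hk : 0 < k)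
    (hK : ∫⁻ y, ENNReal.ofReal (|u y| ^ critExp N s p) = ENNReal.ofReal k) (x : Eu N) :
    ENNReal.ofReal ((1 / 2) ^ critExp N s p *
        (volume.real (Metric.ball (0 : Eu N) 1) / 2) ^ (1 + s * p / N) / k ^ (s * p / N) *
          |u x| ^ critExp N s p) ≤
      ∫⁻ y, ENNReal.ofReal (|u x - u y| ^ p / ‖x - y‖ ^ (N + s * p)) := by
  have : Nonempty (Fin N) := ⟨⟨0, hN⟩⟩
  have hN0 : (0 : ℝ) < N := by exact_mod_cast hN
  have hd : (0 : ℝ) < N - s * p := by linarith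
  set q := critExp N s p with hq
  have hq0 : 0 < q := by rw [hq, critExp]; positivity
  set t := s * p / N with ht
  -- This relation makes the powers of `a = |u x|` balance in `hreal`.
  have hpq : p + q * t = q := by
    have : q * (N - s * p) = N * p := div_mul_cancel₀ _ hd.ne'
    rw [ht]; field_simp; linarith
  set ω := volume.real (Metric.ball (0 : Eu N) 1) with hω
  have hωt : volume (Metric.ball (0 : Eu N) 1) = ENNReal.ofReal ω := by
    rw [hω, ofReal_measureReal Metric.isBounded_ball.measure_lt_top.ne]
  have hω0 : 0 < ω := by
    have := Metric.measure_ball_pos volume (0 : Eu N) one_pos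
    rwa [hωt, ENNReal.ofReal_pos] at this
  by_cases hx : u x = 0
  · simp [hx, Real.zero_rpow hq0.ne']
  set a := |u x| with ha
  have ha0 : 0 < a := abs_pos.2 hx
  -- Chosen so that the ball of radius `r` has volume `2 * k * (2 / a) ^ q`, twice Chebyshev's bound
  -- for the set where `|u| ≥ a / 2`. On at least half of the ball, `u` then differs from `u x` by
  -- at least `a / 2`.
  set V := 2 * k * (2 / a) ^ q / ω with hV
  have hV0 : 0 < V := by positivity
  set r := V ^ (1 / (N : ℝ)) with hr
  have hr0 : 0 < r := by positivity
  have hrN : r ^ N = V := by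
    rw [← Real.rpow_natCast, hr, ← Real.rpow_mul hV0.le, one_div_mul_cancel hN0.ne', Real.rpow_one]
  set B := Metric.ball x r with hB
  have hBv : volume B = ENNReal.ofReal (V * ω) := by
    rw [hB, Measure.addHaar_ball _ _ hr0.le, hωt, finrank_euclideanSpace, Fintype.card_fin, hrN,
      ENNReal.ofReal_mul hV0.le]
  set S := {y | ENNReal.ofReal ((a / 2) ^ q) ≤ ENNReal.ofReal (|u y| ^ q)} with hS
  have hmeas : Measurable fun y => ENNReal.ofReal (|u y| ^ q) := by fun_prop
  have hSm : MeasurableSet S := measurableSet_le measurable_const hmeas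
  have hSv : volume S ≤ ENNReal.ofReal (V * ω / 2) := by
    have h1 := mul_meas_ge_le_lintegral₀ hmeas.aemeasurable (μ := volume)
      (ENNReal.ofReal ((a / 2) ^ q))
    rw [hK] at h1
    have h2 : V * ω / 2 = k * (2 / a) ^ q := by rw [hV]; field_simp
    have h3 : (2 / a) ^ q * (a / 2) ^ q = 1 := by
      rw [← Real.mul_rpow (by positivity) (by positivity)]
      simp [ha0.ne']
    calc volume S = ENNReal.ofReal ((2 / a) ^ q) * (ENNReal.ofReal ((a / 2) ^ q) * volume S) := by
          rw [← mul_assoc, ← ENNReal.ofReal_mul (by positivity), h3]; simp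
      _ ≤ ENNReal.ofReal ((2 / a) ^ q) * ENNReal.ofReal k := by gcongr
      _ = _ := by rw [← ENNReal.ofReal_mul (by positivity), h2, mul_comm]
  have hBS : ENNReal.ofReal (V * ω / 2) ≤ volume (B \ S) := by
    calc ENNReal.ofReal (V * ω / 2)
        = ENNReal.ofReal (V * ω) - ENNReal.ofReal (V * ω / 2) := by
          rw [← ENNReal.ofReal_sub _ (by positivity)]; congr 1; ring
      _ ≤ volume B - volume S := by rw [hBv]; gcongr
      _ ≤ _ := le_measure_sdiff
  have hlow : ∀ y ∈ B \ S, ENNReal.ofReal ((a / 2) ^ p / r ^ (N + s * p)) ≤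
      ENNReal.ofReal (|u x - u y| ^ p / ‖x - y‖ ^ (N + s * p)) := by
    rintro y ⟨hyB, hyS⟩
    have hy : |u y| < a / 2 := by
      by_contra hcon
      exact hyS (ENNReal.ofReal_le_ofReal
        (Real.rpow_le_rpow (by positivity) (not_lt.1 hcon) hq0.le))
    have hdiff : a / 2 ≤ |u x - u y| := by
      have := abs_sub_abs_le_abs_sub (u x) (u y)
      linarith
    have hne : 0 < ‖x - y‖ := by
      rw [norm_pos_iff, sub_ne_zero]
      rintro rfl
      linarith
    have hle : ‖x - y‖ ≤ r := by
      rw [norm_sub_rev, ← dist_eq_norm]; exact (Metric.mem_ball.1 hyB).le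
    gcongr
  have hreal : (1 / 2) ^ q * (ω / 2) ^ (1 + t) / k ^ t * a ^ q =
      (a / 2) ^ p / r ^ (N + s * p) * (V * ω / 2) := by
    have e1 : r ^ (N + s * p) = V * V ^ t := by
      rw [Real.rpow_add hr0, Real.rpow_natCast, hrN, hr, ← Real.rpow_mul hV0.le]
      congr 2; rw [ht]; ring
    have e2 : V ^ t = k ^ t * (a / 2) ^ (-(q * t)) * (ω / 2) ^ (-t) := by
      have : V = k * (a / 2) ^ (-q) * (ω / 2) ^ (-1 : ℝ) := by
        rw [hV, Real.rpow_neg (by positivity), ← Real.inv_rpow (by positivity), inv_div,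
          Real.rpow_neg_one, inv_div]
        field_simp
      rw [this, Real.mul_rpow (by positivity) (by positivity),
        Real.mul_rpow (by positivity) (by positivity), ← Real.rpow_mul (by positivity),
        ← Real.rpow_mul (by positivity)]
      congr 2 <;> congr 1 <;> ring
    rw [e1, e2, Real.rpow_neg (by positivity), Real.rpow_neg (by positivity),
      Real.rpow_add (by positivity), Real.rpow_one]
    have e3 : (1 / 2) ^ q * a ^ q = (a / 2) ^ p * (a / 2) ^ (q * t) := by
      rw [← Real.mul_rpow (by positivity) (by positivity), ← Real.rpow_add (by positivity), hpq]
      congr 1; ring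
    calc _ = ((1 / 2) ^ q * a ^ q) * (ω / 2 * (ω / 2) ^ t) / k ^ t := by ring
      _ = _ := by rw [e3]; field_simp
  rw [hreal, ENNReal.ofReal_mul (by positivity)]
  calc _ ≤ ENNReal.ofReal ((a / 2) ^ p / r ^ (N + s * p)) * volume (B \ S) := by gcongr
    _ = ∫⁻ _ in B \ S, ENNReal.ofReal ((a / 2) ^ p / r ^ (N + s * p)) := by simp
    _ ≤ ∫⁻ y in B \ S, ENNReal.ofReal (|u x - u y| ^ p / ‖x - y‖ ^ (N + s * p)) :=
        setLIntegral_mono' (Metric.isOpen_ball.measurableSet.diff hSm) hlow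
    _ ≤ _ := setLIntegral_le_lintegral _ _

theorem eLpNorm_ofReal_eq {q : ℝ} (hq : 0 < q) (u : Eu N → ℝ) (ν : Measure (Eu N)) :
    eLpNorm u (ENNReal.ofReal q) ν = (∫⁻ y, ENNReal.ofReal (|u y| ^ q) ∂ν) ^ (1 / q) := by
  rw [eLpNorm_eq_lintegral_rpow_enorm_toReal (by simpa) (by simp), ENNReal.toReal_ofReal hq.le]
  congr 2
  ext y
  rw [← ofReal_norm, Real.norm_eq_abs, ENNReal.ofReal_rpow_of_nonneg (abs_nonneg _) hq.le]

/-- The fractional Sobolev inequality. -/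
theorem fracSobolev (hN : 1 ≤ N) {s p : ℝ} (hs0 : 0 < s) (hs1 : s < 1) (hp1 : 1 < p)
    (hsp : s * p < N) : ∃ C : ℝ≥0, ∀ u : Eu N → ℝ, Measurable u →
      eLpNorm u (ENNReal.ofReal (critExp N s p)) volume ≠ ∞ →
      eLpNorm u (ENNReal.ofReal (critExp N s p)) volume ≤ C * gagliardo N s p u := by
  have hp0 : 0 < p := by linarith
  have hN0 : (0 : ℝ) < N := by exact_mod_cast hN
  have hd : (0 : ℝ) < N - s * p := by linarith
  have hq0 : 0 < critExp N s p := by rw [critExp]; positivity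
  have hfc := fracConst_pos hN hs0 hs1 hp1
  set q := critExp N s p with hq
  set c := (1 / 2) ^ q * (volume.real (Metric.ball (0 : Eu N) 1) / 2) ^ (1 + s * p / N) with hc
  have hc0 : 0 < c := by
    have : 0 < volume.real (Metric.ball (0 : Eu N) 1) :=
      ENNReal.toReal_pos (Metric.measure_ball_pos volume _ one_pos).ne'
        Metric.isBounded_ball.measure_lt_top.ne
    positivity
  set D := (fracConst N s p * c) ^ (1 / p) with hD
  have hD0 : 0 < D := by positivity
  refine ⟨(D⁻¹).toNNReal, fun u hu hfin => ?_⟩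
  rw [eLpNorm_ofReal_eq hq0] at hfin ⊢
  set K := ∫⁻ y, ENNReal.ofReal (|u y| ^ q) with hK
  have hKt : K ≠ ∞ := fun h => hfin (by rw [h, ENNReal.top_rpow_of_pos (by positivity)])
  -- The pointwise bound divides by a power of `K`, which must be neither zero nor infinite.
  rcases eq_or_ne K 0 with hK0 | hK0
  · rw [hK0, ENNReal.zero_rpow_of_pos (by positivity)]; exact zero_le
  set k := K.toReal with hk
  have hk0 : 0 < k := ENNReal.toReal_pos hK0 hKt
  have hKk : K = ENNReal.ofReal k := (ENNReal.ofReal_toReal hKt).symm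
  have hint : ENNReal.ofReal (c * k ^ (p / q)) ≤ ∫⁻ z : Eu N × Eu N,
      ENNReal.ofReal (|u z.1 - u z.2| ^ p / ‖z.1 - z.2‖ ^ (N + s * p)) := by
    rw [Measure.volume_eq_prod, lintegral_prod _ (by fun_prop)]
    calc _ = ENNReal.ofReal (c / k ^ (s * p / N)) * K := by
          rw [hKk, ← ENNReal.ofReal_mul (by positivity)]
          congr 1
          -- Integrating the pointwise bound in `x` gives `K` over its power `s * p / N`; what
          -- remains is `k ^ (p / q)`, whose `p`-th root is the critical norm.
          have : p / q = 1 - s * p / N := by rw [hq, critExp]; field_simp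
          rw [this, Real.rpow_sub hk0, Real.rpow_one]
          ring
      _ = ∫⁻ x, ENNReal.ofReal (c / k ^ (s * p / N) * |u x| ^ q) := by
          rw [hK, ← lintegral_const_mul' _ _ ENNReal.ofReal_ne_top]
          congr 1; ext x
          rw [ENNReal.ofReal_mul (by positivity)]
      _ ≤ _ := lintegral_mono fun x => fracSobolev_pointwise hN hs0 hp0 hsp hu hk0 hKk x
  calc K ^ (1 / q) = ENNReal.ofReal (k ^ (1 / q)) := by
        rw [hKk, ENNReal.ofReal_rpow_of_pos hk0]
    _ = ENNReal.ofReal D⁻¹ *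
        (ENNReal.ofReal (fracConst N s p) * ENNReal.ofReal (c * k ^ (p / q))) ^ (1 / p) := by
        rw [← ENNReal.ofReal_mul hfc.le, ENNReal.ofReal_rpow_of_pos (by positivity),
          ← ENNReal.ofReal_mul (by positivity), ← mul_assoc,
          Real.mul_rpow (by positivity) (by positivity), ← hD, inv_mul_cancel_left₀ hD0.ne',
          ← Real.rpow_mul hk0.le]
        congr 2; field_simp
    _ ≤ ENNReal.ofReal D⁻¹ * gagliardo N s p u := by
        unfold gagliardo
        gcongr

/-! ### Control by `‖·‖_μ` -/

section Control

variable {Ω : Opens (Eu N)}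

theorem support_subset (φ : 𝓓(Ω, ℝ)) : Function.support φ ⊆ (Ω : Set (Eu N)) :=
  (subset_tsupport _).trans φ.tsupport_subset

theorem support_gradient_subset (φ : 𝓓(Ω, ℝ)) :
    Function.support (gradient φ) ⊆ (Ω : Set (Eu N)) := by
  intro x hx
  refine φ.tsupport_subset (support_fderiv_subset ℝ (f := φ) fun h => hx ?_)
  simp [gradient, h]

theorem hasCompactSupport_gradient (φ : 𝓓(Ω, ℝ)) : HasCompactSupport (gradient φ) := by
  have h := φ.hasCompactSupport.fderiv (𝕜 := ℝ)
  refine h.mono fun x hx h0 => hx ?_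
  simp [gradient, h0]

theorem memLp_testFunction (φ : 𝓓(Ω, ℝ)) (p : ℝ≥0∞) : MemLp φ p volume :=
  φ.continuous.memLp_of_hasCompactSupport φ.hasCompactSupport

theorem memLp_gradient (φ : 𝓓(Ω, ℝ)) (p : ℝ≥0∞) : MemLp (gradient φ) p volume :=
  (continuous_gradient φ).memLp_of_hasCompactSupport (hasCompactSupport_gradient φ)

/-- A quantity dominated by `[·]_{s,p}` for each `(s,p)` in a set of positive measure is dominated
by `‖·‖_μ`. -/
theorem exists_le_muNorm (μ : Measure (ℝ × ℝ)) [IsFiniteMeasure μ] {A : Set (ℝ × ℝ)}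
    (hAS : A ⊆ Sig N) (hA : 0 < μ A) (G : 𝓓(Ω, ℝ) → ℝ≥0∞)
    (h : ∀ z ∈ A, ∃ C : ℝ≥0, ∀ φ : 𝓓(Ω, ℝ), G φ ≤ C * semi N z.1 z.2 φ) :
    ∃ C : ℝ, 0 < C ∧ ∀ φ : 𝓓(Ω, ℝ), G φ ≤ ENNReal.ofReal C * muNorm μ (φ : Eu N → ℝ) := by
  -- The quantifier over `φ` is inside the set, so the constant obtained is uniform in `φ`. These
  -- sets need not be measurable: the argument uses only countable subadditivity and monotonicity of
  -- the outer measure.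
  let S : ℕ → Set (ℝ × ℝ) := fun k => {z ∈ A | ∀ φ : 𝓓(Ω, ℝ), G φ ≤ (k + 1 : ℕ) * semi N z.1 z.2 φ}
  have hcov : A ⊆ ⋃ k, S k := by
    intro z hz
    obtain ⟨C, hC⟩ := h z hz
    obtain ⟨k, hk⟩ := exists_nat_ge C
    refine mem_iUnion.2 ⟨k, hz, fun φ => (hC φ).trans ?_⟩
    gcongr
    have : C ≤ ((k + 1 : ℕ) : ℝ≥0) := hk.trans (by push_cast; simp)
    exact_mod_cast this
  obtain ⟨k, hk⟩ : ∃ k, 0 < μ (S k) := by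
    by_contra! hcon
    exact hA.ne' (measure_mono_null hcov (measure_iUnion_null fun k => nonpos_iff_eq_zero.1 (hcon k)))
  have hfin : μ (S k) ≠ ∞ := measure_ne_top _ _
  set m := (μ (S k)).toReal with hm
  have hm0 : 0 < m := ENNReal.toReal_pos hk.ne' hfin
  refine ⟨(k + 1 : ℕ) / m, by positivity, fun φ => ?_⟩
  set ε := G φ / (k + 1 : ℕ) with hε
  have hk0 : ((k + 1 : ℕ) : ℝ≥0∞) ≠ 0 := by simp
  have hkt : ((k + 1 : ℕ) : ℝ≥0∞) ≠ ∞ := ENNReal.natCast_ne_top _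
  have hmarkov := mul_meas_ge_le_lintegral₀ (aemeasurable_semi μ φ) ε
  have hsub : S k ⊆ {z | ε ≤ semi N z.1 z.2 φ} := fun z hz =>
    ENNReal.div_le_of_le_mul' (hz.2 φ)
  -- `S k` does not depend on `φ`, whereas the superlevel set in Markov's inequality does; its
  -- measure is thus bounded below uniformly in `φ`.
  have hle : μ (S k) ≤ (μ.restrict (Sig N)) {z | ε ≤ semi N z.1 z.2 φ} := by
    rw [← Measure.restrict_eq_self μ (fun z hz => hAS hz.1 : S k ⊆ Sig N)]
    exact measure_mono hsub
  have hmain : ε * ENNReal.ofReal m ≤ muNorm μ (φ : Eu N → ℝ) := by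
    rw [hm, ENNReal.ofReal_toReal hfin]
    exact (mul_le_mul_right hle _).trans hmarkov
  have hG : G φ = (k + 1 : ℕ) * ε := (ENNReal.mul_div_cancel hk0 hkt).symm
  have hmne : ENNReal.ofReal m ≠ 0 := by simpa using hm0
  rw [ENNReal.ofReal_div_of_pos hm0, ENNReal.ofReal_natCast, hG, div_eq_mul_inv, mul_assoc]
  gcongr
  rw [mul_comm, ← div_eq_mul_inv, ENNReal.le_div_iff_mul_le (Or.inl hmne) (Or.inl (by simp))]
  exact hmain

/-! ### Hölder and Sobolev inequalities for test functions -/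

theorem exists_eLpNorm_le_of_exponent_le (hΩ : Bornology.IsBounded (Ω : Set (Eu N))) {p q : ℝ}
    (hp : 0 < p) (hpq : p ≤ q) (F : Type*) [NormedAddCommGroup F] :
    ∃ C : ℝ≥0, ∀ f : Eu N → F, AEStronglyMeasurable f volume →
      Function.support f ⊆ (Ω : Set (Eu N)) →
      eLpNorm f (ENNReal.ofReal p) volume ≤ C * eLpNorm f (ENNReal.ofReal q) volume := by
  have hle : 1 / q ≤ 1 / p := one_div_le_one_div_of_le hp hpq
  have hfin : volume (Ω : Set (Eu N)) ^ (1 / p - 1 / q) ≠ ∞ :=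
    ENNReal.rpow_ne_top_of_nonneg (by linarith) hΩ.measure_lt_top.ne
  refine ⟨(volume (Ω : Set (Eu N)) ^ (1 / p - 1 / q)).toNNReal, fun f hf hs => ?_⟩
  rw [ENNReal.coe_toNNReal hfin, ← eLpNorm_restrict_eq_of_support_subset hs,
    ← eLpNorm_restrict_eq_of_support_subset (p := ENNReal.ofReal q) hs, mul_comm]
  have := eLpNorm_le_eLpNorm_mul_rpow_measure_univ (ENNReal.ofReal_le_ofReal hpq)
    (hf.restrict (s := (Ω : Set (Eu N))))
  rwa [ENNReal.toReal_ofReal hp.le, ENNReal.toReal_ofReal (hp.le.trans hpq),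
    Measure.restrict_apply_univ] at this

theorem critExp_le_critExp {s p s' p' : ℝ} (hs : s ≤ s') (hs0 : 0 < s') (hp0 : 0 < p)
    (hp : p ≤ p') (h : s' * p' < N) : critExp N s p ≤ critExp N s' p' := by
  have h1 : s * p ≤ s' * p' := by
    calc s * p ≤ s' * p := by gcongr
      _ ≤ s' * p' := by gcongr
  have hd : (0 : ℝ) < N - s' * p' := by linarith
  have hp' : 0 < p' := hp0.trans_le hp
  unfold critExp
  gcongr

theorem le_critExp {s p : ℝ} (hs : 0 < s) (hp0 : 0 < p) (h : s * p < N) : p ≤ critExp N s p := by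
  have hd : (0 : ℝ) < N - s * p := by linarith
  rw [critExp, le_div_iff₀ hd]
  nlinarith [mul_pos (mul_pos hs hp0) hp0]

/-- The Gagliardo–Nirenberg–Sobolev inequality: at `s = 1` the critical exponent is the classical
one, `1 / p* = 1 / p - 1 / N`. -/
theorem sobolev_gradient {p : ℝ} (hp1 : 1 < p) (hpN : p < N) :
    ∃ C : ℝ≥0, ∀ φ : 𝓓(Ω, ℝ), eLpNorm φ (ENNReal.ofReal (critExp N 1 p)) volume ≤
      C * eLpNorm (gradient φ) (ENNReal.ofReal p) volume := by
  have hd : (0 : ℝ) < N - p := by linarith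
  have hN0 : (0 : ℝ) < N := by linarith
  have hq : 0 ≤ critExp N 1 p := by rw [critExp, one_mul]; positivity
  refine ⟨SNormLESNormFDerivOfEqConst ℝ (volume : Measure (Eu N)) p.toNNReal, fun φ => ?_⟩
  have h := eLpNorm_le_eLpNorm_fderiv_of_eq volume (contDiff_one φ) φ.hasCompactSupport
    (p := p.toNNReal) (p' := (critExp N 1 p).toNNReal) (by simpa using hp1.le)
    (by simpa using (by exact_mod_cast hN0 : 0 < N)) (by
      rw [Real.coe_toNNReal _ hq, NNReal.coe_inv, Real.coe_toNNReal _ (by linarith), finrank_euclideanSpace,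
        Fintype.card_fin, critExp]
      have : p ≠ 0 := by linarith
      field_simp)
  have hg : eLpNorm (gradient φ) (ENNReal.ofReal p) volume =
      eLpNorm (fderiv ℝ φ) (ENNReal.ofReal p) volume :=
    eLpNorm_congr_norm_ae (ae_of_all _ fun x => norm_gradient φ x)
  rw [hg]
  exact h

theorem sobolev_semi {s p : ℝ} (hs0 : 0 < s) (hs1 : s ≤ 1) (hp1 : 1 < p) (hpN : p < N) :
    ∃ C : ℝ≥0, ∀ φ : 𝓓(Ω, ℝ), eLpNorm φ (ENNReal.ofReal (critExp N s p)) volume ≤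
      C * semi N s p φ := by
  rcases hs1.eq_or_lt with rfl | hs1
  · simpa [semi] using sobolev_gradient hp1 hpN
  have hN : 1 ≤ N := by exact_mod_cast (hp1.trans hpN).le
  obtain ⟨C, hC⟩ := fracSobolev hN hs0 hs1 hp1 (by nlinarith)
  refine ⟨C, fun φ => ?_⟩
  simpa [semi, hs0.ne', hs1.ne] using
    hC φ φ.continuous.measurable (memLp_testFunction φ _).eLpNorm_ne_top

/-! ### Comparison of Gagliardo seminorms of different orders -/

theorem gagliardo_rpow {s p : ℝ} (hp : 0 < p) (u : Eu N → ℝ) :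
    gagliardo N s p u ^ p = ENNReal.ofReal (fracConst N s p) *
      ∫⁻ z : Eu N × Eu N, ENNReal.ofReal (|u z.1 - u z.2| ^ p / ‖z.1 - z.2‖ ^ (N + s * p)) := by
  rw [gagliardo, ← ENNReal.rpow_mul, one_div_mul_cancel hp.ne', ENNReal.rpow_one]

/-- Near the diagonal, `|x - y| ≤ 1`, a larger order makes the kernel larger. Away from it the
difference is estimated crudely by the two values. The factor `min ‖x - y‖ 1 ^ p` equals one there,
and inserting it makes the kernel integrable over all of space. -/
theorem gagliardo_integrand_le {s σ p : ℝ} (hs : s ≤ σ) (hp : 0 < p) (u : Eu N → ℝ)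
    (z : Eu N × Eu N) :
    ENNReal.ofReal (|u z.1 - u z.2| ^ p / ‖z.1 - z.2‖ ^ (N + s * p)) ≤
      ENNReal.ofReal (|u z.1 - u z.2| ^ p / ‖z.1 - z.2‖ ^ (N + σ * p)) +
      ENNReal.ofReal (2 ^ p) * ((ENNReal.ofReal (|u z.1| ^ p) + ENNReal.ofReal (|u z.2| ^ p)) *
        ENNReal.ofReal (min ‖z.1 - z.2‖ 1 ^ p / ‖z.1 - z.2‖ ^ (N + s * p))) := by
  rcases (norm_nonneg (z.1 - z.2)).eq_or_lt with h0 | h0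
  · have : u z.1 - u z.2 = 0 := by
      rw [sub_eq_zero.1 (norm_eq_zero.1 h0.symm), sub_self]
    rw [this]
    simp [Real.zero_rpow hp.ne']
  rcases le_total ‖z.1 - z.2‖ 1 with h1 | h1
  · refine le_add_right (ENNReal.ofReal_le_ofReal ?_)
    have : ‖z.1 - z.2‖ ^ (N + σ * p) ≤ ‖z.1 - z.2‖ ^ (N + s * p) :=
      Real.rpow_le_rpow_of_exponent_ge h0 h1 (by gcongr)
    gcongr
  · refine le_add_left ?_
    rw [min_eq_right h1, Real.one_rpow, ← ENNReal.ofReal_add (by positivity) (by positivity),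
      ← ENNReal.ofReal_mul (by positivity), ← ENNReal.ofReal_mul (by positivity)]
    apply ENNReal.ofReal_le_ofReal
    rw [mul_one_div, ← mul_div_assoc]
    gcongr
    calc |u z.1 - u z.2| ^ p ≤ (2 * max |u z.1| |u z.2|) ^ p := by
          gcongr
          have := abs_sub (u z.1) (u z.2)
          have := le_max_left |u z.1| |u z.2|
          have := le_max_right |u z.1| |u z.2|
          linarith
      _ = 2 ^ p * max |u z.1| |u z.2| ^ p := Real.mul_rpow (by norm_num) (by positivity)
      _ ≤ _ := by
          gcongr
          have h2 : 0 ≤ |u z.1| ^ p := by positivity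
          have h3 : 0 ≤ |u z.2| ^ p := by positivity
          rcases max_choice |u z.1| |u z.2| with h | h <;> rw [h] <;> linarith

/-- The far part of the integrand is a product of `|u|^p` in one variable and a translate of the
kernel of `lintegral_radial`, so Tonelli and translation invariance factor its integral. -/
theorem lintegral_gagliardo_le {s σ p : ℝ} (hN : 1 ≤ N) (hs0 : 0 < s) (hs1 : s < 1) (hs : s ≤ σ)
    (hp : 1 < p) : ∃ C : ℝ≥0, ∀ u : Eu N → ℝ, Measurable u →
    ∫⁻ z : Eu N × Eu N, ENNReal.ofReal (|u z.1 - u z.2| ^ p / ‖z.1 - z.2‖ ^ (N + s * p)) ≤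
      (∫⁻ z : Eu N × Eu N, ENNReal.ofReal (|u z.1 - u z.2| ^ p / ‖z.1 - z.2‖ ^ (N + σ * p))) +
        C * eLpNorm u (ENNReal.ofReal p) volume ^ p := by
  have hp0 : 0 < p := by linarith
  set G : Eu N → ℝ≥0∞ := fun w => ENNReal.ofReal (min ‖w‖ 1 ^ p / ‖w‖ ^ (N + s * p)) with hG
  have hGm : Measurable G := by fun_prop
  have hGi : ∫⁻ w, G w ≠ ∞ := by
    rw [hG, lintegral_radial hN hs0 hs1 hp]; exact ENNReal.ofReal_ne_top
  refine ⟨(ENNReal.ofReal (2 ^ p) * (2 * ∫⁻ w, G w)).toNNReal, fun u hu => ?_⟩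
  rw [ENNReal.coe_toNNReal (by finiteness), eLpNorm_ofReal_eq hp0, ← ENNReal.rpow_mul,
    one_div_mul_cancel hp0.ne', ENNReal.rpow_one]
  set f : Eu N → ℝ≥0∞ := fun x => ENNReal.ofReal (|u x| ^ p) with hf
  have hfm : Measurable f := by fun_prop
  have hI1 : ∫⁻ z : Eu N × Eu N, f z.1 * G (z.1 - z.2) = (∫⁻ x, f x) * ∫⁻ x, G x := by
    rw [Measure.volume_eq_prod, lintegral_prod _ (by fun_prop)]
    have (x : Eu N) : ∫⁻ y, f x * G (x - y) = f x * ∫⁻ y, G y := by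
      rw [lintegral_const_mul _ (by fun_prop), lintegral_sub_left_eq_self G x]
    simp only [this]
    rw [lintegral_mul_const _ hfm]
  have hI2 : ∫⁻ z : Eu N × Eu N, f z.2 * G (z.1 - z.2) = (∫⁻ x, f x) * ∫⁻ x, G x := by
    rw [Measure.volume_eq_prod, lintegral_prod_symm _ (by fun_prop)]
    have (y : Eu N) : ∫⁻ x, f y * G (x - y) = f y * ∫⁻ x, G x := by
      rw [lintegral_const_mul _ (by fun_prop), lintegral_sub_right_eq_self G y]
    simp only [this]
    rw [lintegral_mul_const _ hfm]
  calc _ ≤ ∫⁻ z : Eu N × Eu N, (ENNReal.ofReal (|u z.1 - u z.2| ^ p / ‖z.1 - z.2‖ ^ (N + σ * p)) +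
        ENNReal.ofReal (2 ^ p) * ((f z.1 + f z.2) * G (z.1 - z.2))) :=
        lintegral_mono fun z => gagliardo_integrand_le hs hp0 u z
    _ = _ := by
        rw [lintegral_add_left (by fun_prop), lintegral_const_mul _ (by fun_prop)]
        simp only [add_mul]
        rw [lintegral_add_left (by fun_prop), hI1, hI2]
        ring

/-- The `L^p` term comes from the Sobolev inequality at order `σ` and Hölder on `Ω`. The same bound
then absorbs the zero-order term in the comparison of orders. -/
theorem fracSobolevNorm_le_gagliardo (hΩ : Bornology.IsBounded (Ω : Set (Eu N))) {s σ p : ℝ}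
    (hs0 : 0 < s) (hs : s ≤ σ) (hσ : σ < 1) (hp1 : 1 < p) (hpN : p < N) :
    ∃ C : ℝ≥0, ∀ φ : 𝓓(Ω, ℝ), fracSobolevNorm s p φ ≤ C * gagliardo N σ p φ := by
  have hN : 1 ≤ N := by exact_mod_cast (hp1.trans hpN).le
  have hp0 : 0 < p := by linarith
  have hσ0 : 0 < σ := hs0.trans_le hs
  have hσp : σ * p < N := by nlinarith
  obtain ⟨C₁, hC₁⟩ := fracSobolev hN hσ0 hσ hp1 hσp
  obtain ⟨C₂, hC₂⟩ := exists_eLpNorm_le_of_exponent_le hΩ hp0 (le_critExp hσ0 hp0 hσp) ℝ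
  obtain ⟨C₃, hC₃⟩ := lintegral_gagliardo_le hN hs0 (hs.trans_lt hσ) hs hp1
  have hLp (φ : 𝓓(Ω, ℝ)) :
      eLpNorm φ (ENNReal.ofReal p) volume ≤ (C₂ * C₁ : ℝ≥0) * gagliardo N σ p φ := by
    push_cast
    rw [mul_assoc]
    refine (hC₂ φ φ.continuous.aestronglyMeasurable (support_subset φ)).trans ?_
    gcongr
    exact hC₁ φ φ.continuous.measurable (memLp_testFunction φ _).eLpNorm_ne_top
  have hfc := fracConst_pos hN hσ0 hσ hp1
  -- The constant for the `p`-th power of the seminorm: the first summand exchanges the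
  -- normalization at `σ` for that at `s`, the second collects the `L^p` contribution.
  set a := ENNReal.ofReal (fracConst N s p) *
    (ENNReal.ofReal (fracConst N σ p)⁻¹ + C₃ * (C₂ * C₁ : ℝ≥0) ^ p) with ha
  have hat : a ≠ ∞ := by
    have : ((C₂ * C₁ : ℝ≥0) : ℝ≥0∞) ^ p ≠ ∞ :=
      ENNReal.rpow_ne_top_of_nonneg hp0.le ENNReal.coe_ne_top
    finiteness
  have hat' : a ^ (1 / p) ≠ ∞ := ENNReal.rpow_ne_top_of_nonneg (by positivity) hat
  refine ⟨C₂ * C₁ + (a ^ (1 / p)).toNNReal, fun φ => ?_⟩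
  rw [ENNReal.coe_add, ENNReal.coe_toNNReal hat', add_mul, fracSobolevNorm]
  refine add_le_add (hLp φ) ?_
  rw [← ENNReal.rpow_le_rpow_iff hp0, ENNReal.mul_rpow_of_nonneg _ _ hp0.le, ← ENNReal.rpow_mul,
    one_div_mul_cancel hp0.ne', ENNReal.rpow_one, gagliardo_rpow hp0 (s := s), ha, mul_assoc]
  gcongr
  refine (hC₃ φ φ.continuous.measurable).trans ?_
  rw [add_mul]
  refine add_le_add (le_of_eq ?_) ?_
  · rw [gagliardo_rpow hp0, ← mul_assoc, ← ENNReal.ofReal_mul (by positivity),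
      inv_mul_cancel₀ hfc.ne', ENNReal.ofReal_one, one_mul]
  · rw [mul_assoc, ← ENNReal.mul_rpow_of_nonneg _ _ hp0.le]
    gcongr
    exact hLp φ

/-! ### The three estimates by `‖·‖_μ` -/

variable (μ : Measure (ℝ × ℝ)) [IsFiniteMeasure μ]

/-- The critical exponent increases in both parameters, so at every `(σ, q)` of the rectangle
Sobolev gives at least the required integrability and Hölder lowers it. -/
theorem exists_eLpNorm_critExp_le (hΩ : Bornology.IsBounded (Ω : Set (Eu N))) {s p : ℝ}
    (hs0 : 0 < s) (hp1 : 1 < p) (hμ : 0 < μ (Icc s 1 ×ˢ Ico p (N : ℝ))) :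
    ∃ C : ℝ, 0 < C ∧ ∀ φ : 𝓓(Ω, ℝ), eLpNorm φ (ENNReal.ofReal (critExp N s p)) volume ≤
      ENNReal.ofReal C * muNorm μ (φ : Eu N → ℝ) := by
  refine exists_le_muNorm μ (A := Icc s 1 ×ˢ Ico p (N : ℝ)) ?_ hμ _ ?_
  · rintro z ⟨hz1, hz2⟩
    exact ⟨⟨hs0.le.trans hz1.1, hz1.2⟩, hp1.trans_le hz2.1, hz2.2⟩
  · rintro ⟨σ, q⟩ ⟨⟨hsσ, hσ1⟩, hpq, hqN⟩
    dsimp only at hsσ hσ1 hpq hqN ⊢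
    have hσq : σ * q < N := by nlinarith
    have hσ0 : 0 < σ := hs0.trans_le hsσ
    have hsp : s * p < N := lt_of_le_of_lt (by gcongr) hσq
    obtain ⟨C₁, hC₁⟩ := sobolev_semi (Ω := Ω) (hs0.trans_le hsσ) hσ1 (hp1.trans_le hpq) hqN
    obtain ⟨C₂, hC₂⟩ := exists_eLpNorm_le_of_exponent_le hΩ
      (lt_of_lt_of_le (by linarith) (le_critExp hs0 (by linarith) hsp))
      (critExp_le_critExp hsσ (hs0.trans_le hsσ) (by linarith) hpq hσq) ℝ
    refine ⟨C₂ * C₁, fun φ => ?_⟩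
    push_cast
    rw [mul_assoc]
    refine (hC₂ φ φ.continuous.aestronglyMeasurable (support_subset φ)).trans ?_
    gcongr
    exact hC₁ φ

/-- On the edge `σ = 1`, Hölder lowers the gradient exponent from `q` to `p`; Sobolev at `p`
followed by Hölder recovers the `L^p` norm. -/
theorem exists_sobolevNorm_le (hΩ : Bornology.IsBounded (Ω : Set (Eu N))) {p : ℝ}
    (hp1 : 1 < p) (hμ : 0 < μ (Icc 1 1 ×ˢ Ico p (N : ℝ))) :
    ∃ C : ℝ, 0 < C ∧ ∀ φ : 𝓓(Ω, ℝ), eLpNorm φ (ENNReal.ofReal p) volume +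
      eLpNorm (gradient φ) (ENNReal.ofReal p) volume ≤
        ENNReal.ofReal C * muNorm μ (φ : Eu N → ℝ) := by
  refine exists_le_muNorm μ (A := Icc 1 1 ×ˢ Ico p (N : ℝ)) ?_ hμ _ ?_
  · rintro z ⟨hz1, hz2⟩
    exact ⟨⟨zero_le_one.trans hz1.1, hz1.2⟩, hp1.trans_le hz2.1, hz2.2⟩
  · rintro ⟨σ, q⟩ ⟨⟨hsσ, hσ1⟩, hpq, hqN⟩
    dsimp only at hsσ hσ1 hpq hqN ⊢
    obtain rfl : σ = 1 := le_antisymm hσ1 hsσ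
    have hp0 : 0 < p := by linarith
    have hpN : 1 * p < N := by linarith
    obtain ⟨C₁, hC₁⟩ := sobolev_gradient (Ω := Ω) hp1 (hpq.trans_lt hqN)
    obtain ⟨C₂, hC₂⟩ := exists_eLpNorm_le_of_exponent_le hΩ hp0 (le_critExp one_pos hp0 hpN) ℝ
    obtain ⟨C₃, hC₃⟩ := exists_eLpNorm_le_of_exponent_le hΩ hp0 hpq (Eu N)
    refine ⟨(C₂ * C₁ + 1) * C₃, fun φ => ?_⟩
    have h1 := hC₂ φ φ.continuous.aestronglyMeasurable (support_subset φ)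
    have h2 := hC₃ _ (continuous_gradient φ).aestronglyMeasurable (support_gradient_subset φ)
    simp only [semi, one_ne_zero, if_false, if_true]
    push_cast
    calc _ ≤ (C₂ : ℝ≥0∞) * (C₁ * eLpNorm (gradient φ) (ENNReal.ofReal p) volume) +
          eLpNorm (gradient φ) (ENNReal.ofReal p) volume := by
          gcongr
          refine h1.trans ?_
          gcongr
          exact hC₁ φ
      _ = ((C₂ : ℝ≥0∞) * C₁ + 1) * eLpNorm (gradient φ) (ENNReal.ofReal p) volume := by ring
      _ ≤ _ := by rw [mul_assoc]; gcongr

/-- The comparison of Gagliardo seminorms changes the order only, hence the restriction to a slice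
with fixed `p`. -/
theorem exists_fracSobolevNorm_le (hΩ : Bornology.IsBounded (Ω : Set (Eu N))) {s p : ℝ}
    (hs0 : 0 < s) (hp1 : 1 < p) (hpN : p < N) (hμ : 0 < μ (Ico s 1 ×ˢ {p})) :
    ∃ C : ℝ, 0 < C ∧ ∀ φ : 𝓓(Ω, ℝ), fracSobolevNorm s p φ ≤
      ENNReal.ofReal C * muNorm μ (φ : Eu N → ℝ) := by
  refine exists_le_muNorm μ (A := Ico s 1 ×ˢ {p}) ?_ hμ _ ?_
  · rintro ⟨σ, q⟩ ⟨⟨hsσ, hσ1⟩, rfl : q = p⟩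
    exact ⟨⟨hs0.le.trans hsσ, hσ1.le⟩, hp1, hpN⟩
  · rintro ⟨σ, q⟩ ⟨⟨hsσ, hσ1⟩, rfl : q = p⟩
    dsimp only at hsσ hσ1 ⊢
    have hσ0 : σ ≠ 0 := (hs0.trans_le hsσ).ne'
    simpa [semi, hσ0, hσ1.ne] using fracSobolevNorm_le_gagliardo hΩ hs0 hsσ hσ1 hp1 hpN

end Control

/-! ### Lower semicontinuity and closability -/

section Limits

variable {Ω : Opens (Eu N)}

/-- Fatou on the product space; a.e. convergence passes to pairs because both projections are
quasi-measure-preserving. -/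
theorem gagliardo_le_of_tendsto {s p : ℝ} (hp : 0 < p) {v : ℕ → Eu N → ℝ} {f : Eu N → ℝ}
    (hv : ∀ n, Measurable (v n)) (hf : ∀ᵐ x, Tendsto (fun n => v n x) atTop (𝓝 (f x))) {C : ℝ≥0∞}
    (hC : ∀ᶠ n in atTop, gagliardo N s p (v n) ≤ C) : gagliardo N s p f ≤ C := by
  rw [← ENNReal.rpow_le_rpow_iff hp, gagliardo_rpow hp,
    ← lintegral_const_mul' _ _ ENNReal.ofReal_ne_top]
  set F : (Eu N → ℝ) → Eu N × Eu N → ℝ≥0∞ := fun u z => ENNReal.ofReal (fracConst N s p) *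
    ENNReal.ofReal (|u z.1 - u z.2| ^ p / ‖z.1 - z.2‖ ^ (N + s * p)) with hF
  have h1 : ∀ᵐ z : Eu N × Eu N, Tendsto (fun n => v n z.1) atTop (𝓝 (f z.1)) :=
    Measure.quasiMeasurePreserving_fst.ae hf
  have h2 : ∀ᵐ z : Eu N × Eu N, Tendsto (fun n => v n z.2) atTop (𝓝 (f z.2)) :=
    Measure.quasiMeasurePreserving_snd.ae hf
  have hFm (n : ℕ) : Measurable (F (v n)) := by
    have := hv n
    fun_prop
  calc ∫⁻ z, F f z ≤ ∫⁻ z, liminf (fun n => F (v n) z) atTop := by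
        refine lintegral_mono_ae ?_
        filter_upwards [h1, h2] with z hz1 hz2
        refine (Tendsto.liminf_eq ?_).ge
        refine ENNReal.Tendsto.const_mul (ENNReal.tendsto_ofReal ?_) (Or.inr ENNReal.ofReal_ne_top)
        exact ((hz1.sub hz2).abs.rpow_const (Or.inr hp.le)).div_const _
    _ ≤ liminf (fun n => ∫⁻ z, F (v n) z) atTop := lintegral_liminf_le hFm
    _ ≤ C ^ p := by
        refine liminf_le_of_frequently_le' (Eventually.frequently ?_)
        filter_upwards [hC] with n hn
        rw [hF, lintegral_const_mul' _ _ ENNReal.ofReal_ne_top, ← gagliardo_rpow hp]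
        gcongr

/-- The two summands are bounded by `C` separately, whence the factor two. -/
theorem fracSobolevNorm_le_of_tendsto {s p : ℝ} (hp : 0 < p) {v : ℕ → Eu N → ℝ} {f : Eu N → ℝ}
    (hv : ∀ n, Measurable (v n)) (hf : ∀ᵐ x, Tendsto (fun n => v n x) atTop (𝓝 (f x))) {C : ℝ≥0∞}
    (hC : ∀ᶠ n in atTop, fracSobolevNorm s p (v n) ≤ C) : fracSobolevNorm s p f ≤ 2 * C := by
  rw [two_mul]
  refine add_le_add (Lp.eLpNorm_le_of_ae_tendsto (hC.mono fun n hn => le_self_add.trans hn)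
    (fun n => (hv n).aestronglyMeasurable) hf) (gagliardo_le_of_tendsto hp hv hf
      (hC.mono fun n hn => le_add_self.trans hn))

/-! ### Weak gradients of limits of test functions -/

theorem inner_gradient (φ : Eu N → ℝ) (x v : Eu N) : inner ℝ v (gradient φ x) = fderiv ℝ φ x v := by
  rw [real_inner_comm, gradient, InnerProductSpace.toDual_symm_apply]

/-- Integration by parts for test functions. -/
theorem setIntegral_smul_gradient (φ ψ : 𝓓(Ω, ℝ)) :
    ∫ x in (Ω : Set (Eu N)), φ x • gradient ψ x =
      -∫ x in (Ω : Set (Eu N)), ψ x • gradient φ x := by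
  have hint (φ ψ : 𝓓(Ω, ℝ)) : Integrable (fun x => φ x • gradient ψ x) :=
    (φ.continuous.smul (continuous_gradient ψ)).integrable_of_hasCompactSupport
      φ.hasCompactSupport.smul_right
  have hset (φ ψ : 𝓓(Ω, ℝ)) :
      ∫ x in (Ω : Set (Eu N)), φ x • gradient ψ x = ∫ x, φ x • gradient ψ x :=
    setIntegral_eq_integral_of_forall_compl_eq_zero fun x hx => by
      have : φ x = 0 := by
        by_contra h
        exact hx (support_subset φ h)
      simp [this]
  rw [hset, hset]
  -- Pairing with a fixed vector reduces to scalar integration by parts for the directional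
  -- derivative along `v` on the whole space.
  refine ext_inner_left ℝ fun v => ?_
  have hinner (φ ψ : 𝓓(Ω, ℝ)) :
      inner ℝ v (∫ x, φ x • gradient ψ x) = ∫ x, φ x * fderiv ℝ ψ x v := by
    have := (innerSL ℝ v).integral_comp_comm (hint φ ψ)
    simp only [innerSL_apply_apply] at this
    rw [← this]
    congr 1; ext x
    rw [real_inner_smul_right, inner_gradient]
  have hint' (φ ψ : 𝓓(Ω, ℝ)) : Integrable (fun x => φ x * fderiv ℝ ψ x v) := by
    have := (innerSL ℝ v).integrable_comp (hint φ ψ)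
    refine this.congr (ae_of_all _ fun x => ?_)
    simp
  rw [inner_neg_right, hinner, hinner]
  have h := integral_mul_fderiv_eq_neg_fderiv_mul_of_integrable (μ := volume) (f := φ) (g := ψ)
    (v := v) (by simpa only [mul_comm] using hint' ψ φ) (hint' φ ψ)
    ((φ.continuous.mul ψ.continuous).integrable_of_hasCompactSupport
      φ.hasCompactSupport.mul_right)
    (fun x _ => (contDiff_one φ).differentiable (by simp) x)
    (fun x _ => (contDiff_one ψ).differentiable (by simp) x)
  rw [h]
  simp only [mul_comm]

theorem tendsto_integral_of_norm_sub_le {α F G : Type*} [MeasurableSpace α] {ν : Measure α}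
    [NormedAddCommGroup F] [NormedAddCommGroup G] [NormedSpace ℝ G] {a : ℕ → α → F} {b : α → F}
    {A : ℕ → α → G} {B : α → G} (hB : AEStronglyMeasurable B ν) (hA : ∀ n, Integrable (A n) ν)
    (hab : Tendsto (fun n => eLpNorm (a n - b) 1 ν) atTop (𝓝 0)) (M : ℝ≥0)
    (hM : ∀ n x, ‖A n x - B x‖ ≤ M * ‖a n x - b x‖) :
    Tendsto (fun n => ∫ x, A n x ∂ν) atTop (𝓝 (∫ x, B x ∂ν)) := by
  refine tendsto_integral_of_L1 B hB (Eventually.of_forall hA) ?_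
  have hlim : Tendsto (fun n => (M : ℝ≥0∞) * eLpNorm (a n - b) 1 ν) atTop (𝓝 0) := by
    simpa using ENNReal.Tendsto.const_mul hab (Or.inr ENNReal.coe_ne_top)
  refine tendsto_of_tendsto_of_tendsto_of_le_of_le tendsto_const_nhds hlim
    (fun _ => zero_le) fun n => ?_
  simp only [eLpNorm_one_eq_lintegral_enorm]
  rw [← lintegral_const_mul' _ _ ENNReal.coe_ne_top]
  refine lintegral_mono fun x => ?_
  have := hM n x
  simp only [← coe_nnnorm] at this
  simp only [enorm_eq_nnnorm, Pi.sub_apply]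
  exact_mod_cast this

/-- Integration by parts against a fixed bounded test function is stable under `L¹` convergence of
both the functions and their gradients. -/
theorem hasWeakGradient_of_tendsto {φ : ℕ → 𝓓(Ω, ℝ)} {f : Eu N → ℝ} {g : Eu N → Eu N}
    (hf : IntegrableOn f (Ω : Set (Eu N))) (hg : IntegrableOn g (Ω : Set (Eu N)))
    (hφf : Tendsto (fun n => eLpNorm (⇑(φ n) - f) 1 (volume.restrict (Ω : Set (Eu N)))) atTop (𝓝 0))
    (hφg : Tendsto (fun n => eLpNorm (gradient (φ n) - g) 1 (volume.restrict (Ω : Set (Eu N))))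
      atTop (𝓝 0)) : HasWeakGradient Ω f g := by
  refine ⟨hf.locallyIntegrableOn, hg.locallyIntegrableOn, fun ψ => ?_⟩
  have hint (φ ψ : 𝓓(Ω, ℝ)) : Integrable (fun x => φ x • gradient ψ x) :=
    (φ.continuous.smul (continuous_gradient ψ)).integrable_of_hasCompactSupport
      φ.hasCompactSupport.smul_right
  obtain ⟨M₁, hM₁⟩ := (continuous_gradient ψ).bounded_above_of_compact_support
    (hasCompactSupport_gradient ψ)
  obtain ⟨M₂, hM₂⟩ := ψ.continuous.bounded_above_of_compact_support ψ.hasCompactSupport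
  have h1 : Tendsto (fun n => ∫ x in (Ω : Set (Eu N)), φ n x • gradient ψ x) atTop
      (𝓝 (∫ x in (Ω : Set (Eu N)), f x • gradient ψ x)) := by
    refine tendsto_integral_of_norm_sub_le
      (hf.aestronglyMeasurable.smul (continuous_gradient ψ).aestronglyMeasurable)
      (fun n => (hint (φ n) ψ).restrict) hφf M₁.toNNReal fun n x => ?_
    rw [← sub_smul, norm_smul, mul_comm]
    gcongr
    exact (hM₁ x).trans (Real.le_coe_toNNReal _)
  have h2 : Tendsto (fun n => ∫ x in (Ω : Set (Eu N)), ψ x • gradient (φ n) x) atTop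
      (𝓝 (∫ x in (Ω : Set (Eu N)), ψ x • g x)) := by
    refine tendsto_integral_of_norm_sub_le
      (ψ.continuous.aestronglyMeasurable.smul hg.aestronglyMeasurable)
      (fun n => (hint ψ (φ n)).restrict) hφg M₂.toNNReal fun n x => ?_
    rw [← smul_sub, norm_smul]
    gcongr
    exact (hM₂ x).trans (Real.le_coe_toNNReal _)
  refine tendsto_nhds_unique h1 ?_
  simp only [fun n => setIntegral_smul_gradient (φ n) ψ]
  exact h2.neg

/-- The fundamental lemma of the calculus of variations; this is what makes the gradient closable.
-/
theorem HasWeakGradient.ae_eq_zero {g : Eu N → Eu N} (h : HasWeakGradient Ω 0 g) :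
    g =ᵐ[volume.restrict (Ω : Set (Eu N))] 0 := by
  have := Ω.isOpen.ae_eq_zero_of_integral_contDiff_smul_eq_zero h.2.1 fun ψ h1 h2 h3 => by
    have h4 := h.2.2 ⟨ψ, h1, h2, h3⟩
    simp only [Pi.zero_apply, zero_smul, integral_zero, zero_eq_neg, TestFunction.coe_mk] at h4
    rw [← h4, eq_comm]
    refine setIntegral_eq_integral_of_forall_compl_eq_zero fun x hx => ?_
    rw [show ψ x = 0 from image_eq_zero_of_notMem_tsupport fun hx' => hx (h3 hx'), zero_smul]
  exact (ae_restrict_iff' Ω.isOpen.measurableSet).2 this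

theorem gradient_sub (φ ψ : 𝓓(Ω, ℝ)) : gradient ⇑(φ - ψ) = gradient φ - gradient ψ := by
  have h := gradient_add (φ - ψ) ψ
  have h' : (⇑(φ - ψ) + ⇑ψ : Eu N → ℝ) = φ := by
    ext x; simp
  rw [h'] at h
  rw [h, add_sub_cancel_right]

/-- If the gradients of test functions have summable increments in `L^p`, they converge. -/
theorem exists_gradient_limit {p : ℝ} (hp : 1 ≤ p) (φ : ℕ → 𝓓(Ω, ℝ)) (d : ℕ → ℝ≥0∞)
    (hd : ∀ n, eLpNorm (gradient ⇑(φ n - φ (n + 1))) (ENNReal.ofReal p) volume ≤ d n)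
    (hsum : ∑' n, d n ≠ ∞) :
    ∃ g, MemLp g (ENNReal.ofReal p) (volume.restrict (Ω : Set (Eu N))) ∧
      ∀ n, eLpNorm (gradient (φ n) - g) (ENNReal.ofReal p) (volume.restrict (Ω : Set (Eu N))) ≤
        ∑' m, d (n + m) := by
  have : Fact (1 ≤ ENNReal.ofReal p) := ⟨by simpa using hp⟩
  have hm (n : ℕ) : MemLp (gradient (φ n)) (ENNReal.ofReal p)
      (volume.restrict (Ω : Set (Eu N))) := (memLp_gradient (φ n) _).restrict _
  have hdist (n : ℕ) : edist (hm n).toLp (hm (n + 1)).toLp ≤ d n := by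
    rw [Lp.edist_toLp_toLp, ← gradient_sub]
    exact (eLpNorm_mono_measure _ Measure.restrict_le_self).trans (hd n)
  -- Completeness of `L^p`; summable increments also give the tail bound on the distance to the
  -- limit.
  obtain ⟨g, hg⟩ := cauchySeq_tendsto_of_complete
    (cauchySeq_of_edist_le_of_tsum_ne_top (f := fun n => (hm n).toLp) d hdist hsum)
  refine ⟨g, Lp.memLp g, fun n => ?_⟩
  have := edist_le_tsum_of_edist_le_of_tendsto (f := fun n => (hm n).toLp) d hdist hg n
  rw [← Lp.toLp_coeFn g (Lp.memLp g), Lp.edist_toLp_toLp] at this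
  exact this

theorem tendsto_eLpNorm_one {F : Type*} [NormedAddCommGroup F]
    (hΩ : Bornology.IsBounded (Ω : Set (Eu N))) {p : ℝ} (hp : 1 ≤ p) {a : ℕ → Eu N → F}
    (ha : ∀ n, AEStronglyMeasurable (a n) (volume.restrict (Ω : Set (Eu N))))
    (h : Tendsto (fun n => eLpNorm (a n) (ENNReal.ofReal p) (volume.restrict (Ω : Set (Eu N))))
      atTop (𝓝 0)) :
    Tendsto (fun n => eLpNorm (a n) 1 (volume.restrict (Ω : Set (Eu N)))) atTop (𝓝 0) := by
  have hp' : 1 ≤ ENNReal.ofReal p := by simpa using hp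
  have hexp : 0 ≤ 1 / (1 : ℝ≥0∞).toReal - 1 / (ENNReal.ofReal p).toReal := by
    rw [ENNReal.toReal_one, ENNReal.toReal_ofReal (by linarith), sub_nonneg]
    exact one_div_le_one_div_of_le one_pos hp
  have hfin : (volume.restrict (Ω : Set (Eu N))) univ ^
      (1 / (1 : ℝ≥0∞).toReal - 1 / (ENNReal.ofReal p).toReal) ≠ ∞ := by
    rw [Measure.restrict_apply_univ]
    exact ENNReal.rpow_ne_top_of_nonneg hexp hΩ.measure_lt_top.ne
  refine tendsto_of_tendsto_of_tendsto_of_le_of_le tendsto_const_nhds ?_ (fun _ => zero_le)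
    fun n => eLpNorm_le_eLpNorm_mul_rpow_measure_univ hp' (ha n)
  simpa using ENNReal.Tendsto.mul_const h (Or.inr hfin)

theorem integrableOn_of_memLp {F : Type*} [NormedAddCommGroup F]
    (hΩ : Bornology.IsBounded (Ω : Set (Eu N))) {p : ℝ} (hp : 1 ≤ p) {g : Eu N → F}
    (hg : MemLp g (ENNReal.ofReal p) (volume.restrict (Ω : Set (Eu N)))) :
    IntegrableOn g (Ω : Set (Eu N)) := by
  have : IsFiniteMeasure (volume.restrict (Ω : Set (Eu N))) :=
    ⟨by simpa using hΩ.measure_lt_top⟩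
  exact hg.integrable (by simpa using hp)

/-! ### Closability of the seminorms and of `‖·‖_μ` -/

theorem semi_sub_le_sum {s p : ℝ} (hp : 1 < p) (φ : ℕ → 𝓓(Ω, ℝ)) (n : ℕ) :
    semi N s p ⇑(φ 0 - φ n) ≤ ∑ m ∈ Finset.range n, semi N s p ⇑(φ m - φ (m + 1)) := by
  induction n with
  | zero =>
    have h := semi_smul (s := s) hp 0 (φ 0)
    simp only [zero_smul, abs_zero, ENNReal.ofReal_zero, zero_mul] at h
    simp [h]
  | succ n ih =>
    rw [Finset.sum_range_succ]
    have h : (⇑(φ 0 - φ (n + 1)) : Eu N → ℝ) = ⇑(φ 0 - φ n) + ⇑(φ n - φ (n + 1)) := by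
      ext x; simp
    rw [h]
    exact (semi_add hp _ _).trans (by gcongr)

/-- Closability of `[·]_{s,p}`, in a quantitative form. -/
theorem semi_le_tsum (hΩ : Bornology.IsBounded (Ω : Set (Eu N))) {s p : ℝ} (hp : 1 < p)
    {φ : ℕ → 𝓓(Ω, ℝ)}
    (hL1 : Tendsto (fun n => eLpNorm (φ n) 1 (volume.restrict (Ω : Set (Eu N)))) atTop (𝓝 0))
    (hae : ∀ᵐ x, Tendsto (fun n => φ n x) atTop (𝓝 0)) :
    semi N s p (φ 0) ≤ ∑' m, semi N s p ⇑(φ m - φ (m + 1)) := by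
  have hsum (n : ℕ) := (semi_sub_le_sum (s := s) hp φ n).trans (ENNReal.sum_le_tsum _)
  -- `φ 0` is the a.e. limit of the telescoping differences `φ 0 - φ n`, so lower semicontinuity
  -- suffices except at `s = 1`.
  have hae' : ∀ᵐ x, Tendsto (fun n => (φ 0 - φ n) x) atTop (𝓝 (φ 0 x)) := by
    filter_upwards [hae] with x hx
    simpa using hx.const_sub (φ 0 x)
  by_cases hs0 : s = 0
  · simp only [semi, hs0, if_true] at hsum ⊢
    exact Lp.eLpNorm_le_of_ae_tendsto (Eventually.of_forall hsum)
      (fun n => (φ 0 - φ n).continuous.aestronglyMeasurable) hae'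
  by_cases hs1 : s = 1
  -- A.e. convergence of the functions does not control their classical gradients. Instead the
  -- gradients converge in `L^p` to a weak gradient of zero, hence to zero, and the distance of the
  -- initial gradient from this limit is at most the full sum.
  · simp only [semi, hs1, one_ne_zero, if_false, if_true]
    by_cases htop : ∑' m, eLpNorm (gradient ⇑(φ m - φ (m + 1))) (ENNReal.ofReal p) volume = ∞
    · rw [htop]; exact le_top
    obtain ⟨g, hg, hlim⟩ := exists_gradient_limit hp.le φ _ (fun n => le_rfl) htop
    have hzero : g =ᵐ[volume.restrict (Ω : Set (Eu N))] 0 := by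
      refine (hasWeakGradient_of_tendsto (φ := φ) (f := 0) integrableOn_zero
        (integrableOn_of_memLp hΩ hp.le hg) (by simpa using hL1) ?_).ae_eq_zero
      refine tendsto_eLpNorm_one hΩ hp.le (fun n =>
        (continuous_gradient (φ n)).aestronglyMeasurable.sub hg.aestronglyMeasurable) ?_
      refine tendsto_of_tendsto_of_tendsto_of_le_of_le tendsto_const_nhds ?_ (fun _ => zero_le) hlim
      have := ENNReal.tendsto_sum_nat_add _ htop
      simpa only [add_comm] using this
    have h0 := hlim 0
    simp only [zero_add] at h0
    rw [← eLpNorm_restrict_eq_of_support_subset (support_gradient_subset (φ 0))]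
    refine le_trans (le_of_eq (eLpNorm_congr_ae ?_)) h0
    filter_upwards [hzero] with x hx
    simp [hx]
  · simp only [semi, hs0, hs1, if_false] at hsum ⊢
    exact gagliardo_le_of_tendsto (by linarith) (fun n => (φ 0 - φ n).continuous.measurable) hae'
      (Eventually.of_forall hsum)

/-- The hypotheses do not mention `(s, p)`, so the pointwise inequality can be integrated and the
sum exchanged with the integral. -/
theorem muNorm_le_tsum (μ : Measure (ℝ × ℝ)) (hΩ : Bornology.IsBounded (Ω : Set (Eu N)))
    {φ : ℕ → 𝓓(Ω, ℝ)}
    (hL1 : Tendsto (fun n => eLpNorm (φ n) 1 (volume.restrict (Ω : Set (Eu N)))) atTop (𝓝 0))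
    (hae : ∀ᵐ x, Tendsto (fun n => φ n x) atTop (𝓝 0)) :
    muNorm μ (φ 0 : Eu N → ℝ) ≤ ∑' m, muNorm μ (⇑(φ m - φ (m + 1)) : Eu N → ℝ) := by
  unfold muNorm
  rw [← lintegral_tsum fun m => aemeasurable_semi μ _]
  exact setLIntegral_mono' (measurableSet_Icc.prod measurableSet_Ioo)
    fun z hz => semi_le_tsum hΩ hz.2.1 hL1 hae

end Limits

/-! ### Realization of `X_μ(Ω)` as a space of functions -/

section Realization

variable {Ω : Opens (Eu N)} (μ : Measure (ℝ × ℝ)) [IsFiniteMeasure μ]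

theorem toX_sub (φ ψ : 𝓓(Ω, ℝ)) : toX μ (φ - ψ) = toX μ φ - toX μ ψ :=
  UniformSpace.Completion.coe_sub (α := PreX μ Ω) φ ψ

theorem denseRange_toX : DenseRange (toX μ : 𝓓(Ω, ℝ) → X μ Ω) :=
  UniformSpace.Completion.denseRange_coe (α := PreX μ Ω)

/-- If `‖·‖_μ` dominates the `L¹` norm of test functions, then `X_μ(Ω)` maps to `L¹(Ω)`. -/
theorem exists_toL1 {C : ℝ} (hC0 : 0 < C)
    (hC : ∀ φ : 𝓓(Ω, ℝ), eLpNorm φ 1 volume ≤ ENNReal.ofReal C * muNorm μ (φ : Eu N → ℝ)) :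
    ∃ T : X μ Ω →L[ℝ] Lp ℝ 1 (volume.restrict (Ω : Set (Eu N))), ∀ φ : 𝓓(Ω, ℝ),
      T (toX μ φ) = ((memLp_testFunction φ 1).restrict (Ω : Set (Eu N))).toLp := by
  let f : PreX μ Ω →ₗ[ℝ] Lp ℝ 1 (volume.restrict (Ω : Set (Eu N))) :=
    { toFun := fun φ => ((memLp_testFunction (Ω := Ω) φ 1).restrict (Ω : Set (Eu N))).toLp
      map_add' := fun φ ψ => MemLp.toLp_add _ _
      map_smul' := fun c φ => MemLp.toLp_const_smul c _ }
  have hf (φ : PreX μ Ω) : ‖f φ‖ ≤ C * ‖φ‖ := by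
    have h1 : ‖f φ‖ = (eLpNorm (show 𝓓(Ω, ℝ) from φ) 1
        (volume.restrict (Ω : Set (Eu N)))).toReal :=
      Lp.norm_toLp _ ((memLp_testFunction (Ω := Ω) φ 1).restrict (Ω : Set (Eu N)))
    have h2 : ‖φ‖ = (muNorm μ (show 𝓓(Ω, ℝ) from φ : Eu N → ℝ)).toReal := rfl
    rw [h1, h2, ← ENNReal.toReal_ofReal hC0.le, ← ENNReal.toReal_mul]
    exact ENNReal.toReal_mono (ENNReal.mul_ne_top ENNReal.ofReal_ne_top (muNorm_ne_top μ _))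
      ((eLpNorm_mono_measure _ Measure.restrict_le_self).trans (hC φ))
  refine ⟨(f.mkContinuous C hf).extend UniformSpace.Completion.toComplL, fun φ => ?_⟩
  exact (f.mkContinuous C hf).extend_eq UniformSpace.Completion.denseRange_coe
    (UniformSpace.Completion.isUniformInducing_coe _) φ

/-- A sequence of test functions which converges to `u` in `X_μ(Ω)` at a geometric rate relative
to `‖u‖`, and to `f` in `L¹(Ω)` and a.e. -/
structure IsApprox (u : X μ Ω) (f : MeasFun Ω) (φ : ℕ → 𝓓(Ω, ℝ)) : Prop where
  tendsto : Tendsto (fun n => toX μ (φ n)) atTop (𝓝 u)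
  muNorm_le : ∀ n, muNorm μ (φ n : Eu N → ℝ) ≤ 2 * ENNReal.ofReal ‖u‖
  muNorm_sub_le : ∀ n m, n ≤ m →
    muNorm μ (⇑(φ n - φ m) : Eu N → ℝ) ≤ 2⁻¹ ^ n * (2 * ENNReal.ofReal ‖u‖)
  memLp : MemLp f 1 (volume.restrict (Ω : Set (Eu N)))
  tendsto_eLpNorm : Tendsto (fun n => eLpNorm (⇑(φ n) - ⇑f) 1 (volume.restrict (Ω : Set (Eu N))))
    atTop (𝓝 0)
  ae_tendsto : ∀ᵐ x, Tendsto (fun n => φ n x) atTop (𝓝 (zeroExt f x))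

/-- The error is relative to `‖u‖`, so that later bounds are multiples of `‖u‖` with no additive
term. For `u = 0` density gives no exact equality, and the zero sequence is used. -/
theorem exists_seq_toX (u : X μ Ω) :
    ∃ φ : ℕ → 𝓓(Ω, ℝ), ∀ n, ‖toX μ (φ n) - u‖ ≤ 2⁻¹ ^ n * ‖u‖ := by
  have (n : ℕ) : ∃ φ : 𝓓(Ω, ℝ), ‖toX μ φ - u‖ ≤ 2⁻¹ ^ n * ‖u‖ := by
    rcases eq_or_ne u 0 with rfl | hu
    · have h : toX μ (0 : 𝓓(Ω, ℝ)) = 0 := UniformSpace.Completion.coe_zero (α := PreX μ Ω)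
      exact ⟨0, by simp [h]⟩
    · obtain ⟨φ, hφ⟩ := (denseRange_toX μ).exists_dist_lt u
        (ε := 2⁻¹ ^ n * ‖u‖) (by have := norm_pos_iff.2 hu; positivity)
      exact ⟨φ, by rw [← dist_eq_norm, dist_comm]; exact hφ.le⟩
  choose φ hφ using this
  exact ⟨φ, hφ⟩

variable {μ}

/-- `L¹` convergence yields an a.e. convergent subsequence. Its `n`-th index is at least `n`, so the
geometric rate survives. -/
theorem exists_isApprox {T : X μ Ω →L[ℝ] Lp ℝ 1 (volume.restrict (Ω : Set (Eu N)))}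
    (hT : ∀ φ : 𝓓(Ω, ℝ),
      T (toX μ φ) = ((memLp_testFunction φ 1).restrict (Ω : Set (Eu N))).toLp) (u : X μ Ω) :
    ∃ φ, IsApprox μ u (T u : MeasFun Ω) φ := by
  obtain ⟨ψ, hψ⟩ := exists_seq_toX μ u
  have hlim : Tendsto (fun n => toX μ (ψ n)) atTop (𝓝 u) := by
    rw [tendsto_iff_norm_sub_tendsto_zero]
    refine squeeze_zero (fun _ => norm_nonneg _) hψ ?_
    simpa using (tendsto_pow_atTop_nhds_zero_of_lt_one (r := (2⁻¹ : ℝ)) (by norm_num)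
      (by norm_num)).mul_const ‖u‖
  have hL1 : Tendsto (fun n => eLpNorm (⇑(ψ n) - ⇑(T u : MeasFun Ω)) 1
      (volume.restrict (Ω : Set (Eu N)))) atTop (𝓝 0) := by
    have h1 := tendsto_iff_edist_tendsto_0.1 ((T.continuous.tendsto u).comp hlim)
    refine h1.congr fun n => ?_
    rw [Function.comp_apply, hT, ← Lp.toLp_coeFn (T u) (Lp.memLp (T u)), Lp.edist_toLp_toLp]
    simp
  obtain ⟨ns, hns, hae⟩ := (tendstoInMeasure_of_tendsto_eLpNorm one_ne_zero
    (fun n => (ψ n).continuous.aestronglyMeasurable)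
    (Lp.aestronglyMeasurable (T u)) hL1).exists_seq_tendsto_ae
  have hclose (n : ℕ) : ‖toX μ (ψ (ns n)) - u‖ ≤ 2⁻¹ ^ n * ‖u‖ := by
    refine (hψ _).trans ?_
    gcongr ?_ * _
    exact pow_le_pow_of_le_one (by norm_num) (by norm_num) (hns.id_le n)
  have hpow (n : ℕ) : (2⁻¹ : ℝ) ^ n ≤ 1 := pow_le_one₀ (by norm_num) (by norm_num)
  refine ⟨fun n => ψ (ns n), hlim.comp hns.tendsto_atTop, fun n => ?_, fun n m hnm => ?_,
    Lp.memLp (T u), hL1.comp hns.tendsto_atTop, ?_⟩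
  · rw [← norm_toX, ← ENNReal.ofReal_ofNat 2, ← ENNReal.ofReal_mul (by norm_num)]
    apply ENNReal.ofReal_le_ofReal
    have h1 := norm_le_norm_add_norm_sub' (toX μ (ψ (ns n))) u
    have h2 := hclose n
    have h3 := mul_le_mul_of_nonneg_right (hpow n) (norm_nonneg u)
    linarith
  · have h0 : (2⁻¹ : ℝ≥0∞) ^ n = ENNReal.ofReal (2⁻¹ ^ n) := by
      rw [ENNReal.ofReal_pow (by norm_num), ENNReal.ofReal_inv_of_pos (by norm_num)]
      simp
    rw [← norm_toX, toX_sub, h0, ← ENNReal.ofReal_ofNat 2, ← ENNReal.ofReal_mul (by norm_num),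
      ← ENNReal.ofReal_mul (by positivity)]
    apply ENNReal.ofReal_le_ofReal
    have h1 := norm_sub_le_norm_sub_add_norm_sub (toX μ (ψ (ns n))) u (toX μ (ψ (ns m)))
    rw [norm_sub_rev u] at h1
    have h2 := hclose n
    have h3 : ‖toX μ (ψ (ns m)) - u‖ ≤ 2⁻¹ ^ n * ‖u‖ := by
      refine (hclose m).trans ?_
      gcongr ?_ * _
      exact pow_le_pow_of_le_one (by norm_num) (by norm_num) hnm
    linarith
  -- Outside `Ω` the test functions and the zero extension all vanish, so convergence holds a.e. in
  -- the whole space.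
  · filter_upwards [(ae_restrict_iff' Ω.isOpen.measurableSet).1 hae] with x hx
    by_cases hxΩ : x ∈ (Ω : Set (Eu N))
    · simpa [zeroExt, hxΩ] using hx hxΩ
    · have (n : ℕ) : ψ (ns n) x = 0 := by
        by_contra h
        exact hxΩ (support_subset _ h)
      simp [zeroExt, hxΩ, this]

theorem exists_rate_lt {K : ℝ≥0∞} (hK : K ≠ ∞) {ε : ℝ≥0∞} (hε : 0 < ε) :
    ∃ n : ℕ, 2⁻¹ ^ n * K < ε := by
  have h := ENNReal.Tendsto.mul_const (b := K)
    (ENNReal.tendsto_pow_atTop_nhds_zero_of_lt_one (r := 2⁻¹) (by simp)) (Or.inr hK)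
  rw [zero_mul] at h
  exact (h.eventually_lt_const hε).exists

theorem sobolevNorm_le {p : ℝ} {f : Eu N → ℝ} {g : Eu N → Eu N} (h : HasWeakGradient Ω f g) :
    sobolevNorm Ω p f ≤ eLpNorm f (ENNReal.ofReal p) (volume.restrict (Ω : Set (Eu N))) +
      eLpNorm g (ENNReal.ofReal p) (volume.restrict (Ω : Set (Eu N))) := by
  unfold sobolevNorm
  gcongr
  exact iInf₂_le g h

/-! ### Passing to the limit along approximating sequences -/

namespace IsApprox

variable {u : X μ Ω} {f : MeasFun Ω} {φ : ℕ → 𝓓(Ω, ℝ)}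

theorem ae_restrict_tendsto (h : IsApprox μ u f φ) :
    ∀ᵐ x ∂volume.restrict (Ω : Set (Eu N)), Tendsto (fun n => φ n x) atTop (𝓝 (f x)) := by
  rw [ae_restrict_iff' Ω.isOpen.measurableSet]
  filter_upwards [h.ae_tendsto] with x hx hxΩ
  simpa [zeroExt, hxΩ] using hx

/-- This gives injectivity of the realization: the approximants of an element realized by zero
satisfy the hypotheses of `muNorm_le_tsum`, which forces their norms to zero. -/
theorem eq_zero (hΩ : Bornology.IsBounded (Ω : Set (Eu N))) (h : IsApprox μ u f φ) (hf : f = 0) :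
    u = 0 := by
  have hf0 : f =ᵐ[volume.restrict (Ω : Set (Eu N))] (0 : Eu N → ℝ) := hf ▸ AEEqFun.coeFn_zero
  have hL1 : Tendsto (fun n => eLpNorm (φ n) 1 (volume.restrict (Ω : Set (Eu N)))) atTop (𝓝 0) := by
    refine h.tendsto_eLpNorm.congr fun n => eLpNorm_congr_ae ?_
    filter_upwards [hf0] with x hx
    simp [hx]
  have hae : ∀ᵐ x, Tendsto (fun n => φ n x) atTop (𝓝 0) := by
    filter_upwards [h.ae_tendsto, (ae_restrict_iff' Ω.isOpen.measurableSet).1 hf0] with x hx hx0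
    by_cases hxΩ : x ∈ (Ω : Set (Eu N))
    · simpa [zeroExt, hxΩ, hx0 hxΩ] using hx
    · simpa [zeroExt, hxΩ] using hx
  set K := 2 * ENNReal.ofReal ‖u‖ with hK
  have hKt : K ≠ ∞ := by finiteness
  -- Closability is applied to the tail starting at `n`, whose increments form a geometric series of
  -- sum `2⁻¹ ^ n * (2 * K)`.
  have hbound (n : ℕ) : muNorm μ (φ n : Eu N → ℝ) ≤ 2⁻¹ ^ n * (2 * K) := by
    have hshift : Tendsto (fun m => n + m) atTop atTop :=
      tendsto_atTop_mono (fun m => Nat.le_add_left m n) tendsto_id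
    have h1 := muNorm_le_tsum μ hΩ (φ := fun m => φ (n + m)) (hL1.comp hshift)
      (hae.mono fun x hx => hx.comp hshift)
    refine h1.trans ((ENNReal.tsum_le_tsum fun m => h.muNorm_sub_le (n + m) (n + (m + 1))
      (by lia)).trans (le_of_eq ?_))
    simp only [pow_add]
    rw [ENNReal.tsum_mul_right, ENNReal.tsum_mul_left, ENNReal.tsum_geometric,
      ENNReal.one_sub_inv_two, inv_inv, mul_assoc]
  have hlim : Tendsto (fun n => ENNReal.ofReal ‖toX μ (φ n)‖) atTop (𝓝 0) := by
    refine tendsto_of_tendsto_of_tendsto_of_le_of_le tendsto_const_nhds ?_ (fun _ => zero_le)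
      fun n => (norm_toX μ (φ n)).le.trans (hbound n)
    have := ENNReal.Tendsto.mul_const (b := 2 * K)
      (ENNReal.tendsto_pow_atTop_nhds_zero_of_lt_one (r := 2⁻¹) (by simp)) (Or.inr (by finiteness))
    simpa using this
  have hlim' := ENNReal.tendsto_ofReal h.tendsto.norm
  have := tendsto_nhds_unique hlim' hlim
  simpa using this

theorem eLpNorm_le (h : IsApprox μ u f φ) {q : ℝ≥0∞} {C : ℝ}
    (hC : ∀ φ : 𝓓(Ω, ℝ), eLpNorm φ q volume ≤ ENNReal.ofReal C * muNorm μ (φ : Eu N → ℝ)) :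
    eLpNorm f q (volume.restrict (Ω : Set (Eu N))) ≤
      ENNReal.ofReal C * (2 * ENNReal.ofReal ‖u‖) := by
  refine Lp.eLpNorm_le_of_ae_tendsto (Eventually.of_forall fun n => ?_)
    (fun n => (φ n).continuous.aestronglyMeasurable) h.ae_restrict_tendsto
  refine (eLpNorm_mono_measure _ Measure.restrict_le_self).trans ((hC _).trans ?_)
  gcongr
  exact h.muNorm_le n

/-- With `n` fixed, the differences `φ n - φ m` converge a.e. as `m` grows, and Fatou keeps their
bound. -/
theorem eLpNorm_sub_le (h : IsApprox μ u f φ) {q : ℝ≥0∞} {C : ℝ}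
    (hC : ∀ φ : 𝓓(Ω, ℝ), eLpNorm φ q volume ≤ ENNReal.ofReal C * muNorm μ (φ : Eu N → ℝ)) (n : ℕ) :
    eLpNorm (fun x => f x - φ n x) q (volume.restrict (Ω : Set (Eu N))) ≤
      2⁻¹ ^ n * (ENNReal.ofReal C * (2 * ENNReal.ofReal ‖u‖)) := by
  have hswap : eLpNorm (fun x => f x - φ n x) q (volume.restrict (Ω : Set (Eu N))) =
      eLpNorm (fun x => φ n x - f x) q (volume.restrict (Ω : Set (Eu N))) :=
    eLpNorm_sub_comm f (φ n) q _
  rw [hswap]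
  refine Lp.eLpNorm_le_of_ae_tendsto (f := fun m => ⇑(φ n - φ m)) (u := atTop) ?_
    (fun m => (φ n - φ m).continuous.aestronglyMeasurable) ?_
  · filter_upwards [eventually_ge_atTop n] with m hm
    refine (eLpNorm_mono_measure _ Measure.restrict_le_self).trans ((hC _).trans ?_)
    rw [mul_left_comm]
    gcongr
    exact h.muNorm_sub_le n m hm
  · filter_upwards [h.ae_restrict_tendsto] with x hx
    simpa using hx.const_sub (φ n x)

/-- The weak gradient of a function in `X_μ(Ω)`. -/
theorem exists_weakGradient (hΩ : Bornology.IsBounded (Ω : Set (Eu N))) (h : IsApprox μ u f φ)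
    {p : ℝ} (hp : 1 ≤ p) {C : ℝ}
    (hC : ∀ φ : 𝓓(Ω, ℝ), eLpNorm (gradient φ) (ENNReal.ofReal p) volume ≤
      ENNReal.ofReal C * muNorm μ (φ : Eu N → ℝ)) :
    ∃ g, HasWeakGradient Ω f g ∧
      (∀ n, HasWeakGradient Ω (fun x => f x - φ n x) (g - gradient (φ n)) ∧
        eLpNorm (g - gradient (φ n)) (ENNReal.ofReal p) (volume.restrict (Ω : Set (Eu N))) ≤
          2⁻¹ ^ n * (2 * (ENNReal.ofReal C * (2 * ENNReal.ofReal ‖u‖)))) ∧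
      eLpNorm g (ENNReal.ofReal p) (volume.restrict (Ω : Set (Eu N))) ≤
        3 * (ENNReal.ofReal C * (2 * ENNReal.ofReal ‖u‖)) := by
  set K := ENNReal.ofReal C * (2 * ENNReal.ofReal ‖u‖) with hK
  have hKt : K ≠ ∞ := by finiteness
  have hgeom (n : ℕ) : ∑' m, (2⁻¹ : ℝ≥0∞) ^ (n + m) * K = 2⁻¹ ^ n * (2 * K) := by
    simp only [pow_add]
    rw [ENNReal.tsum_mul_right, ENNReal.tsum_mul_left, ENNReal.tsum_geometric,
      ENNReal.one_sub_inv_two, inv_inv, mul_assoc]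
  obtain ⟨g, hg, hlim⟩ := exists_gradient_limit hp φ (fun n => 2⁻¹ ^ n * K) (fun n => by
      refine (hC _).trans ?_
      rw [hK, mul_left_comm]
      gcongr
      exact h.muNorm_sub_le n (n + 1) n.le_succ) (by
      have := hgeom 0
      simp only [zero_add] at this
      rw [this]
      finiteness)
  simp only [hgeom] at hlim
  have hgi := integrableOn_of_memLp hΩ hp hg
  have hfi : IntegrableOn f (Ω : Set (Eu N)) := memLp_one_iff_integrable.1 h.memLp
  have hg1 : Tendsto (fun n => eLpNorm (gradient (φ n) - g) 1 (volume.restrict (Ω : Set (Eu N))))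
      atTop (𝓝 0) := by
    refine tendsto_eLpNorm_one hΩ hp (fun n =>
      (continuous_gradient (φ n)).aestronglyMeasurable.sub hg.aestronglyMeasurable) ?_
    refine tendsto_of_tendsto_of_tendsto_of_le_of_le tendsto_const_nhds ?_ (fun _ => zero_le) hlim
    have := ENNReal.Tendsto.mul_const (b := 2 * K)
      (ENNReal.tendsto_pow_atTop_nhds_zero_of_lt_one (r := 2⁻¹) (by simp)) (Or.inr (by finiteness))
    simpa using this
  have hdiff (n : ℕ) : eLpNorm (g - gradient (φ n)) (ENNReal.ofReal p)
      (volume.restrict (Ω : Set (Eu N))) ≤ 2⁻¹ ^ n * (2 * K) := by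
    rw [eLpNorm_sub_comm]; exact hlim n
  refine ⟨g, hasWeakGradient_of_tendsto hfi hgi h.tendsto_eLpNorm hg1, fun n => ⟨?_, hdiff n⟩, ?_⟩
  · refine hasWeakGradient_of_tendsto (φ := fun m => φ m - φ n)
      (hfi.sub ((memLp_one_iff_integrable.1 (memLp_testFunction (φ n) 1)).integrableOn))
      (hgi.sub ((memLp_one_iff_integrable.1 (memLp_gradient (φ n) 1)).integrableOn)) ?_ ?_
    · refine h.tendsto_eLpNorm.congr fun m => ?_
      congr 1
      ext x
      simp
    · refine hg1.congr fun m => ?_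
      rw [gradient_sub, sub_sub_sub_cancel_right]
  · have h0 := hdiff 0
    rw [pow_zero, one_mul] at h0
    have hp' : 1 ≤ ENNReal.ofReal p := by simpa using hp
    calc eLpNorm g (ENNReal.ofReal p) (volume.restrict (Ω : Set (Eu N)))
        = eLpNorm ((g - gradient (φ 0)) + gradient (φ 0)) (ENNReal.ofReal p)
          (volume.restrict (Ω : Set (Eu N))) := by rw [sub_add_cancel]
      _ ≤ 2 * K + K := by
          refine (eLpNorm_add_le
            (hg.aestronglyMeasurable.sub (continuous_gradient (φ 0)).aestronglyMeasurable)
            (continuous_gradient (φ 0)).aestronglyMeasurable hp').trans (add_le_add h0 ?_)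
          refine (eLpNorm_mono_measure _ Measure.restrict_le_self).trans ((hC _).trans ?_)
          rw [hK]
          gcongr
          exact h.muNorm_le 0
      _ = 3 * K := by ring

/-- The approximants themselves witness the closure: `f - φ n` has weak gradient `g - gradient (φ
n)`, and both terms decay geometrically. -/
theorem mem_W01 (hΩ : Bornology.IsBounded (Ω : Set (Eu N))) (h : IsApprox μ u f φ)
    {p : ℝ} (hp : 1 ≤ p) {C : ℝ}
    (hC : ∀ φ : 𝓓(Ω, ℝ), eLpNorm φ (ENNReal.ofReal p) volume +
      eLpNorm (gradient φ) (ENNReal.ofReal p) volume ≤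
        ENNReal.ofReal C * muNorm μ (φ : Eu N → ℝ)) :
    f ∈ W01 Ω p ∧ sobolevNorm Ω p f ≤ 4 * (ENNReal.ofReal C * (2 * ENNReal.ofReal ‖u‖)) := by
  have hC₁ (φ : 𝓓(Ω, ℝ)) := le_self_add.trans (hC φ)
  have hC₂ (φ : 𝓓(Ω, ℝ)) := le_add_self.trans (hC φ)
  obtain ⟨g, hg, hgn, hgK⟩ := h.exists_weakGradient hΩ hp hC₂
  set K := ENNReal.ofReal C * (2 * ENNReal.ofReal ‖u‖) with hK
  constructor
  · intro ε hε
    obtain ⟨n, hn⟩ := exists_rate_lt (K := 3 * K) (by finiteness) hε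
    refine ⟨φ n, lt_of_le_of_lt ?_ hn⟩
    refine (sobolevNorm_le (hgn n).1).trans ((add_le_add (h.eLpNorm_sub_le hC₁ n)
      (hgn n).2).trans (le_of_eq ?_))
    rw [← hK]
    ring
  · refine (sobolevNorm_le hg).trans ((add_le_add (h.eLpNorm_le hC₁) hgK).trans (le_of_eq ?_))
    rw [← hK]
    ring

theorem mem_W0s (h : IsApprox μ u f φ) {s p : ℝ} (hp : 0 < p) {C : ℝ}
    (hC : ∀ φ : 𝓓(Ω, ℝ), fracSobolevNorm s p φ ≤
      ENNReal.ofReal C * muNorm μ (φ : Eu N → ℝ)) :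
    f ∈ W0s Ω s p ∧
      fracSobolevNorm s p (zeroExt f) ≤ 2 * (ENNReal.ofReal C * (2 * ENNReal.ofReal ‖u‖)) := by
  constructor
  · intro ε hε
    obtain ⟨n, hn⟩ := exists_rate_lt
      (K := 2 * (ENNReal.ofReal C * (2 * ENNReal.ofReal ‖u‖)))
      (by finiteness) hε
    refine ⟨φ n, lt_of_le_of_lt ?_ hn⟩
    rw [mul_left_comm]
    -- The error `f - φ n` is the a.e. limit of test functions as `m` grows, so the test function
    -- estimate and lower semicontinuity bound its norm.
    refine fracSobolevNorm_le_of_tendsto hp (v := fun m => ⇑(φ m - φ n))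
      (fun m => (φ m - φ n).continuous.measurable) ?_ ?_
    · filter_upwards [h.ae_tendsto] with x hx
      simpa using hx.sub_const (φ n x)
    · filter_upwards [eventually_ge_atTop n] with m hm
      refine (hC _).trans ?_
      rw [mul_left_comm]
      gcongr
      have h1 : muNorm μ (⇑(φ m - φ n) : Eu N → ℝ) = muNorm μ (⇑(φ n - φ m) : Eu N → ℝ) := by
        rw [← norm_toX, ← norm_toX, toX_sub, toX_sub, norm_sub_rev]
      rw [h1]
      exact h.muNorm_sub_le n m hm
  · refine fracSobolevNorm_le_of_tendsto hp (v := fun m => ⇑(φ m))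
      (fun m => (φ m).continuous.measurable) h.ae_tendsto (Eventually.of_forall fun n => ?_)
    refine (hC _).trans ?_
    gcongr
    exact h.muNorm_le n

end IsApprox

end Realization

end FracSuperposition

end

/-! ### The embedding theorem -/

open MeasureTheory Set TopologicalSpace FracSuperposition in
open scoped ENNReal Distributions in
theorem proposition2p3 (N : ℕ) (hN : 2 ≤ N)
    (Ω : Opens (EuclideanSpace ℝ (Fin N)))
    (hΩ : Bornology.IsBounded (Ω : Set (EuclideanSpace ℝ (Fin N))))
    (μ : Measure (ℝ × ℝ)) [IsFiniteMeasure μ]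
    (sbar pbar : ℝ) (hsbar : sbar ∈ Ioc (0 : ℝ) 1) (hpbar : pbar ∈ Ioo (1 : ℝ) N)
    (hμ : 0 < μ (Icc sbar 1 ×ˢ Ico pbar (N : ℝ))) :
    -- `T` identifies the elements of `X_μ(Ω)` with functions on `Ω`
    ∃ T : X μ Ω →ₗ[ℝ] MeasFun Ω,
      Function.Injective T ∧
      (∀ φ : 𝓓(Ω, ℝ), T (toX μ φ) =ᵐ[volume.restrict (Ω : Set (EuclideanSpace ℝ (Fin N)))] φ) ∧
      (∀ s ∈ Icc sbar 1, ∀ p ∈ Ico pbar (N : ℝ), 0 < μ (Icc s 1 ×ˢ Ico p (N : ℝ)) →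
        (s = 1 → ∃ C : ℝ, 0 < C ∧ ∀ u : X μ Ω,
          T u ∈ W01 Ω p ∧ sobolevNorm Ω p (T u) ≤ ENNReal.ofReal (C * ‖u‖)) ∧
        (s < 1 → ∃ C : ℝ, 0 < C ∧ ∀ u : X μ Ω,
          MemLp (T u) (ENNReal.ofReal (N * p / (N - s * p)))
            (volume.restrict (Ω : Set (EuclideanSpace ℝ (Fin N)))) ∧
          eLpNorm (T u) (ENNReal.ofReal (N * p / (N - s * p)))
            (volume.restrict (Ω : Set (EuclideanSpace ℝ (Fin N)))) ≤
              ENNReal.ofReal (C * ‖u‖))) ∧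
      (∀ s₁ ∈ Ioo (0 : ℝ) 1, ∀ p₁ ∈ Ioo (1 : ℝ) N, 0 < μ (Ico s₁ 1 ×ˢ {p₁}) →
        ∃ C : ℝ, 0 < C ∧ ∀ u : X μ Ω,
          T u ∈ W0s Ω s₁ p₁ ∧
          fracSobolevNorm s₁ p₁ (zeroExt (T u)) ≤ ENNReal.ofReal (C * ‖u‖)) := by
  have hΩ' : Bornology.IsBounded (Ω : Set (Eu N)) := hΩ
  -- The positivity assumption at `(sbar, pbar)` yields an `L¹` bound. One map into `L¹` then serves
  -- for all exponents, each embedding being a property of the same realization.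
  obtain ⟨C, hC0, hC⟩ : ∃ C : ℝ, 0 < C ∧ ∀ φ : 𝓓(Ω, ℝ), eLpNorm φ 1 volume ≤
      ENNReal.ofReal C * muNorm μ (φ : Eu N → ℝ) := by
    obtain ⟨C₁, hC₁0, hC₁⟩ := exists_eLpNorm_critExp_le μ hΩ' hsbar.1 hpbar.1 hμ
    have hp0 : 0 < pbar := by linarith [hpbar.1]
    have hsp : sbar * pbar < N := by nlinarith [hsbar.2, hpbar.2]
    obtain ⟨C₂, hC₂⟩ := exists_eLpNorm_le_of_exponent_le hΩ' one_pos
      (hpbar.1.le.trans (le_critExp hsbar.1 hp0 hsp)) ℝ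
    rw [ENNReal.ofReal_one] at hC₂
    -- The Hölder constant `C₂` may vanish; adding one keeps the product positive.
    refine ⟨(C₂ + 1) * C₁, by positivity, fun φ => ?_⟩
    rw [ENNReal.ofReal_mul (by positivity), mul_assoc]
    refine (hC₂ φ φ.continuous.aestronglyMeasurable (support_subset φ)).trans
      (mul_le_mul' ?_ (hC₁ φ))
    rw [← ENNReal.ofReal_coe_nnreal]
    exact ENNReal.ofReal_le_ofReal (by linarith)
  obtain ⟨T, hT⟩ := exists_toL1 μ hC0 hC
  have happrox := exists_isApprox hT
  have hrescale (k C : ℝ) (hk : 0 ≤ k) (hC : 0 ≤ C) (u : X μ Ω) :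
      ENNReal.ofReal k * (ENNReal.ofReal C * (2 * ENNReal.ofReal ‖u‖)) =
        ENNReal.ofReal (k * C * 2 * ‖u‖) := by
    rw [← ENNReal.ofReal_ofNat 2, ← ENNReal.ofReal_mul (by norm_num), ← ENNReal.ofReal_mul hC,
      ← ENNReal.ofReal_mul hk]
    congr 1
    ring
  let ι := (Lp.LpSubmodule ℝ ℝ 1 (volume.restrict (Ω : Set (Eu N)))).subtype
  refine ⟨ι ∘ₗ T.toLinearMap, ?_, fun φ => ?_, fun s hs p hp hsp => ⟨?_, fun hs1 => ?_⟩,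
    fun s hs p hp hsp => ?_⟩
  · rw [injective_iff_map_eq_zero]
    intro u hu
    obtain ⟨φ, hφ⟩ := happrox u
    exact hφ.eq_zero hΩ' hu
  · have h : (T (toX μ φ) : Eu N → ℝ) =ᵐ[volume.restrict (Ω : Set (Eu N))] φ := by
      rw [hT]
      exact MemLp.coeFn_toLp _
    exact h
  · rintro rfl
    have hp1 : 1 < p := hpbar.1.trans_le hp.1
    obtain ⟨C, hC0, hC⟩ := exists_sobolevNorm_le μ hΩ' hp1 hsp
    refine ⟨4 * C * 2, by positivity, fun u => ?_⟩
    obtain ⟨φ, hφ⟩ := happrox u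
    have h := hφ.mem_W01 hΩ' hp1.le hC
    have e := hrescale 4 C (by norm_num) hC0.le u
    rw [ENNReal.ofReal_ofNat] at e
    exact ⟨h.1, h.2.trans e.le⟩
  · obtain ⟨C, hC0, hC⟩ := exists_eLpNorm_critExp_le μ hΩ' (hsbar.1.trans_le hs.1)
      (hpbar.1.trans_le hp.1) hsp
    refine ⟨1 * C * 2, by positivity, fun u => ?_⟩
    obtain ⟨φ, hφ⟩ := happrox u
    have e := hrescale 1 C zero_le_one hC0.le u
    rw [ENNReal.ofReal_one, one_mul] at e
    have h := (hφ.eLpNorm_le hC).trans e.le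
    exact ⟨⟨hφ.memLp.aestronglyMeasurable, h.trans_lt ENNReal.ofReal_lt_top⟩, h⟩
  · obtain ⟨C, hC0, hC⟩ := exists_fracSobolevNorm_le μ hΩ' hs.1 hp.1 hp.2 hsp
    refine ⟨2 * C * 2, by positivity, fun u => ?_⟩
    obtain ⟨φ, hφ⟩ := happrox u
    have h := hφ.mem_W0s (by linarith [hp.1]) hC
    have e := hrescale 2 C (by norm_num) hC0.le u
    rw [ENNReal.ofReal_ofNat] at e
    exact ⟨h.1, h.2.trans e.le⟩
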